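/- Let $k$ be a field and let $Q$ be the infinite ladder quiver with vertices $a_i,b_i$ ($i\in\mathbb Z$) and arrows $\alpha_i:a_i\to b_i$, $\beta_{i+1}:a_{i+1}\to a_i$, $\gamma_i:b_i\to b_{i+1}$ ($i\in\mathbb Z$). Let $\mathcal C$ be the $k$-category $kQ/I$, where $kQ$ is the $k$-linear path category of $Q$ and $I$ is the ideal generated by the relations $\gamma_i\alpha_i\beta_{i+1}=\alpha_{i+1}$ for $i\neq 0$ and $\gamma_0\alpha_0\beta_1=0$. A grading of $\mathcal C$ by a group $\Gamma$ is a decomposition ${}_y\mathcal C_x=\bigoplus_{s\in\Gamma}X^s{}_y\mathcal C_x$ of each space of morphisms from $x$ to $y$ such that composites of morphisms of degrees $t$ and $s$ have degree $ts$; it is connected if any two objects are joined by walks of non-zero homogeneous morphisms (traversed forwards or backwards) of every degree. Its Galois covering is the functor $F_X:\mathcal C\#X\to\mathcal C$, $(x,s)\mapsto x$, where $\mathcal C\#X$ has objects the pairs $(x,s)$ with $x\in\mathcal C_0$, $s\in\Gamma$, and morphisms from $(x,s)$ to $(y,t)$ given by $X^{t^{-1}s}{}_y\mathcal C_x$. A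 morphism from $F_X$ to $F_Y$ is a pair $(H,J)$ with $H:\mathcal C\#X\to\mathcal C\#Y$ a functor and $J$ a $k$-linear automorphism of $\mathcal C$ which is the identity on objects, such that $F_YH=JF_X$. The intrinsic fundamental group $\pi_1(\mathcal C,c_0)$ is the automorphism group of the fibre functor $F_X\mapsto F_X^{-1}(c_0)$ on the category of Galois coverings of $\mathcal C$ given by connected gradings. A connected grading $U$ is universal if for every connected grading $X$ and all objects $p$ of $\mathcal C\#U$, $q$ of $\mathcal C\#X$ with $F_U(p)=F_X(q)$ there is a unique functor $H:\mathcal C\#U\to\mathcal C\#X$ with $F_XH=F_U$ and $H(p)=q$. Then: 1. $\mathcal C$ has infinitely many objects, it is connected (any two objects are joined by a walk of non-zero morphisms) and Schurian (each space of morphisms has dimension $0$ or $1$). 2. $\mathcal C$ has no admissible presentation: it is not isomorphic to $kQ'/I'$ for any quiver $Q'$ and any ideal $I'$ contained in the square of the ideal generated by the arrows of $Q'$; in particular this holds for every $I'$ that moreover contains, between any two given vertices, all long enough paths; that is, for every admissible ideal $I'$. 3. Let $CW(\mathcal C)$ be the CW-complex whose vertices are the objects, with an edge for each non-zero space of morphisms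 between distinct objects, and with a $2$-cell attached to the triangle $x\to y\to z$, $x\to z$ exactly when composites of non-zero morphisms $x\to y$, $y\to z$ are non-zero. Then the $i$-th square $a_{i+1}\to a_i\to b_i\to b_{i+1}$, $a_{i+1}\to b_{i+1}$ is filled by $2$-cells (one of its two diagonals cuts it into two triangles which both carry a $2$-cell) if and only if $i\neq 0$. 4. $\mathcal C$ admits a universal grading, the group of every universal grading of $\mathcal C$ is isomorphic to $\mathbb Z$, and $\pi_1(\mathcal C,c_0)\cong\mathbb Z$ for every object $c_0$. -/

import Mathlib

open CategoryTheory

universe u v w z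

noncomputable section

namespace SchurianLadder

/-! ### Linear categories, Schurian categories, connectedness, two-cells -/

section LinearCategories

variable (k : Type z) [Field k] (C : Type u) [Category.{v} C] [Preadditive C]

/-- A linear category is Schurian when every space of morphisms has dimension zero or one. -/
def IsSchurian [Linear k C] : Prop :=
  ∀ x y : C, Module.rank k (x ⟶ y) = 0 ∨ Module.rank k (x ⟶ y) = 1

/-- A linear category is connected when any two objects are joined by a walk of non-zero
morphisms, each of them traversed forwards or backwards. -/
def IsWalkConnected : Prop :=
  ∀ x y : C, Relation.EqvGen (fun x y : C => ∃ f : x ⟶ y, f ≠ 0) x y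

variable {C}

/-- In the CW-complex of a Schurian category (vertices: objects; edges: non-zero spaces of
morphisms between distinct objects), a two-cell is attached to the triangle
`x → y → z`, `x → z` exactly when the composite of non-zero morphisms `x ⟶ y` and `y ⟶ z`
is non-zero. -/
def IsTwoCell (x y z : C) : Prop :=
  ∃ (f : x ⟶ y) (g : y ⟶ z), f ≫ g ≠ 0

/-- A square with vertices `p, q, r, s`, whose sides are three arrows `p → q → r → s` and an arrow
`p → s`, is filled by two-cells: it is cut by one of its two diagonals into two triangles which
both carry a two-cell. -/
def SquareIsFilled (p q r s : C) : Prop :=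
  (IsTwoCell p q r ∧ IsTwoCell p r s) ∨ (IsTwoCell q r s ∧ IsTwoCell p q s)

end LinearCategories

/-! ### Gradings and their smash product coverings -/

section Gradings

variable (k : Type z) [Field k] (C : Type u) [Category.{v} C] [Preadditive C] [Linear k C]

open scoped Classical in
/-- A grading of the `k`-category `C` by the group `Γ`. In the diagrammatic order of composition,
`f` of degree `s` followed by `g` of degree `t` has degree `t * s`. -/
structure Grading (Γ : Type w) [Group Γ] where
  comp : ∀ x y : C, Γ → Submodule k (x ⟶ y)
  isInternal : ∀ x y : C, DirectSum.IsInternal (comp x y)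
  comp_mem : ∀ {x y z : C} {s t : Γ} {f : x ⟶ y} {g : y ⟶ z},
    f ∈ comp x y s → g ∈ comp y z t → f ≫ g ∈ comp x z (t * s)

variable {k C}

namespace Grading

variable {Γ : Type w} [Group Γ] (X : Grading k C Γ)

/-- Identities are homogeneous of degree `1`. -/
theorem id_mem (x : C) : 𝟙 x ∈ X.comp x x 1 := by
  classical
  have hint : DirectSum.IsInternal (X.comp x x) := by
    convert X.isInternal x x
  let := hint.chooseDecomposition
  set e : Γ → (x ⟶ x) := fun s => (DirectSum.decompose (X.comp x x) (𝟙 x) s : x ⟶ x) with he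
  have hmem : ∀ s, e s ∈ X.comp x x s := fun s => (DirectSum.decompose (X.comp x x) (𝟙 x) s).2
  have hsum : ∑ s ∈ (DirectSum.decompose (X.comp x x) (𝟙 x)).support, e s = 𝟙 x :=
    DirectSum.sum_support_decompose (X.comp x x) (𝟙 x)
  have key : ∀ (t : Γ) (f : x ⟶ x), f ∈ X.comp x x t → f ≫ e 1 = f := by
    intro t f hf
    have hm : ∀ s, f ≫ e s ∈ X.comp x x (s * t) := fun s => X.comp_mem hf (hmem s)
    have h1 : f = ∑ s ∈ (DirectSum.decompose (X.comp x x) (𝟙 x)).support, f ≫ e s := by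
      rw [← Preadditive.comp_sum, hsum, Category.comp_id]
    have h2 : (DirectSum.decompose (X.comp x x) f t : x ⟶ x) = f :=
      DirectSum.decompose_of_mem_same (X.comp x x) hf
    have h3 : ∀ s, (DirectSum.decompose (X.comp x x) (f ≫ e s) t : x ⟶ x)
        = if s = 1 then f ≫ e 1 else 0 := by
      intro s
      by_cases h : s = 1
      · subst h
        simpa using DirectSum.decompose_of_mem_same (X.comp x x)
          (show f ≫ e 1 ∈ X.comp x x t by simpa using hm 1)
      · rw [if_neg h]
        exact DirectSum.decompose_of_mem_ne (X.comp x x) (hm s) (fun h' => h (by simpa using h'))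
    let π : (x ⟶ x) →+ (x ⟶ x) :=
      { toFun := fun g => (DirectSum.decompose (X.comp x x) g t : x ⟶ x)
        map_zero' := by simp
        map_add' := by simp }
    have h4 : π f = ∑ s ∈ (DirectSum.decompose (X.comp x x) (𝟙 x)).support,
        if s = 1 then f ≫ e 1 else 0 := by
      conv_lhs => rw [h1]
      rw [map_sum]
      exact Finset.sum_congr rfl fun s _ => h3 s
    rw [show π f = f from h2, Finset.sum_ite_eq'] at h4
    split_ifs at h4 with hs
    · exact h4.symm
    · rw [DFinsupp.notMem_support_iff] at hs
      have h0 : e 1 = 0 := by simp [he, hs]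
      rw [h0, Limits.comp_zero, h4]
  have : 𝟙 x ≫ e 1 = 𝟙 x := by
    conv_lhs => rw [← hsum]
    rw [Preadditive.sum_comp, Finset.sum_congr rfl (fun s _ => key s (e s) (hmem s)), hsum]
  rw [Category.id_comp] at this
  rw [← this]
  exact hmem 1

/-- `X.HomogWalk x y s`: there is a walk from `x` to `y` of degree `s` made of non-zero
homogeneous morphisms, each of them traversed forwards or backwards. -/
inductive HomogWalk : C → C → Γ → Prop
  | nil (x : C) : HomogWalk x x 1
  | forward {x y z : C} {s t : Γ} (f : y ⟶ z) (hf : f ≠ 0) (hft : f ∈ X.comp y z t)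
      (p : HomogWalk x y s) : HomogWalk x z (t * s)
  | backward {x y z : C} {s t : Γ} (f : z ⟶ y) (hf : f ≠ 0) (hft : f ∈ X.comp z y t)
      (p : HomogWalk x y s) : HomogWalk x z (t⁻¹ * s)

/-- A grading is connected when any two objects are joined by homogeneous walks of every degree. -/
def IsConnected : Prop := ∀ (x y : C) (s : Γ), X.HomogWalk x y s

/-- The objects of the smash product category `C # X`. -/
@[ext]
structure Smash (X : Grading k C Γ) where
  obj : C
  deg : Γ

/-- The morphisms of `C # X` from `(x, s)` to `(y, t)` are the morphisms of `C` from `x` to `y`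
which are homogeneous of degree `t⁻¹ * s`. -/
instance : Category.{v} (Smash X) where
  Hom p q := X.comp p.obj q.obj (q.deg⁻¹ * p.deg)
  id p := ⟨𝟙 p.obj, by simpa using X.id_mem p.obj⟩
  comp {p q r} f g := ⟨f.1 ≫ g.1, by
    have := X.comp_mem f.2 g.2
    simpa [mul_assoc] using this⟩
  id_comp f := Subtype.ext (Category.id_comp f.1)
  comp_id f := Subtype.ext (Category.comp_id f.1)
  assoc f g h := Subtype.ext (Category.assoc f.1 g.1 h.1)

/-- The Galois covering `C # X ⥤ C`. -/
def proj : Smash X ⥤ C where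
  obj p := p.obj
  map f := f.1

end Grading

variable (k C)

/-- A connected grading of `C`, together with its group. -/
structure ConnGrading where
  Γ : Type w
  [group : Group Γ]
  grading : Grading k C Γ
  connected : grading.IsConnected

attribute [instance] ConnGrading.group

variable {k C}

namespace ConnGrading

/-- The smash product Galois covering of a connected grading. -/
abbrev Cover (X : ConnGrading.{u, v, w, z} k C) := Grading.Smash X.grading

/-- The covering functor. -/
abbrev proj (X : ConnGrading.{u, v, w, z} k C) : X.Cover ⥤ C := X.grading.proj

/-- A morphism of Galois coverings: a commutative square of functors `(H, J)`, where `J` is a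
`k`-linear automorphism of `C` which is the identity on objects (bijective on each space of
morphisms, that is, full and faithful). The functor `H` is then automatically `k`-linear, the
covering functors being linear and faithful. -/
@[ext]
structure Hom (X Y : ConnGrading.{u, v, w, z} k C) where
  H : X.Cover ⥤ Y.Cover
  J : C ⥤ C
  obj_eq : ∀ x, J.obj x = x
  additive : J.Additive
  linear : J.Linear k
  full : J.Full
  faithful : J.Faithful
  comm : H ⋙ Y.proj = X.proj ⋙ J

/-- The category of (smash product) Galois coverings of `C`. -/
instance : Category (ConnGrading.{u, v, w, z} k C) where
  Hom X Y := Hom X Y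
  id X :=
    { H := 𝟭 _
      J := 𝟭 _
      obj_eq := fun _ => rfl
      additive := inferInstance
      linear := inferInstance
      full := inferInstance
      faithful := inferInstance
      comm := rfl }
  comp {X Y Z} a b :=
    { H := a.H ⋙ b.H
      J := a.J ⋙ b.J
      obj_eq := fun x => (congrArg b.J.obj (a.obj_eq x)).trans (b.obj_eq x)
      additive := by
        have := a.additive
        have := b.additive
        infer_instance
      linear := by
        have := a.linear
        have := b.linear
        infer_instance
      full := by
        have := a.full
        have := b.full
        infer_instance
      faithful := by
        have := a.faithful
        have := b.faithful
        infer_instance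
      comm := by
        rw [Functor.assoc, b.comm, ← Functor.assoc, a.comm, Functor.assoc] }

/-- The covering functor commutes on objects with the morphisms of coverings. -/
theorem Hom.proj_obj {X Y : ConnGrading.{u, v, w, z} k C} (a : Hom X Y) (p : X.Cover) :
    Y.proj.obj (a.H.obj p) = X.proj.obj p :=
  (Functor.congr_obj a.comm p).trans (a.obj_eq _)

/-- The fibre of the covering over an object. -/
def Fibre (X : ConnGrading.{u, v, w, z} k C) (c₀ : C) : Type (max u w) :=
  { p : X.Cover // X.proj.obj p = c₀ }

/-- A connected grading is universal when its covering is a universal covering: it maps,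
over the identity of `C`, to every connected Galois covering, in exactly one way
once the image of a point has been prescribed. -/
def IsUniversal (U : ConnGrading.{u, v, w, z} k C) : Prop :=
  ∀ (X : ConnGrading.{u, v, w, z} k C) (p : U.Cover) (q : X.Cover),
    U.proj.obj p = X.proj.obj q →
      ∃! H : U.Cover ⥤ X.Cover, H ⋙ X.proj = U.proj ∧ H.obj p = q

end ConnGrading

variable (k)

/-- The fibre functor over the object `c₀`, on the category of Galois coverings of `C`. -/
def fibreFunctor (c₀ : C) : ConnGrading.{u, v, w, z} k C ⥤ Type (max u w) where
  obj X := X.Fibre c₀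
  map {_ _} a := ↾fun p => ⟨(ConnGrading.Hom.H a).obj p.1, (ConnGrading.Hom.proj_obj a p.1).trans p.2⟩
  map_id _ := rfl
  map_comp _ _ := rfl

/-- The intrinsic fundamental group of `C` at `c₀`: the group of automorphisms of the fibre
functor over `c₀`. -/
abbrev IntrinsicFundamentalGroup (c₀ : C) := Aut (fibreFunctor.{u, v, w, z} k c₀)

end Gradings

/-! ### Quotients of linear categories, path categories, presentations -/

section Quotients

variable (k : Type z) [Field k] {C : Type u} [Category.{v} C] [Preadditive C] [Linear k C]

/-- The two-sided ideal of `C` generated by a family of morphisms. -/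
def idealSpan (R : ∀ ⦃x y : C⦄, (x ⟶ y) → Prop) (x y : C) : Submodule k (x ⟶ y) :=
  Submodule.span k
    { h | ∃ (x' y' : C) (f : x ⟶ x') (r : x' ⟶ y') (g : y' ⟶ y), R r ∧ h = f ≫ r ≫ g }

/-- Congruence modulo the ideal generated by `R`. -/
def idealRel (R : ∀ ⦃x y : C⦄, (x ⟶ y) → Prop) : HomRel C :=
  fun x y f g => f - g ∈ idealSpan k R x y

variable (R : ∀ ⦃x y : C⦄, (x ⟶ y) → Prop)

theorem comp_mem_idealSpan_left {x y z : C} (f : x ⟶ y) {g : y ⟶ z}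
    (hg : g ∈ idealSpan k R y z) : f ≫ g ∈ idealSpan k R x z := by
  have : idealSpan k R y z ≤ (idealSpan k R x z).comap (Linear.leftComp k z f) := by
    refine Submodule.span_le.2 ?_
    rintro _ ⟨x', y', a, r, b, hr, rfl⟩
    exact Submodule.subset_span ⟨x', y', f ≫ a, r, b, hr, by simp⟩
  exact this hg

theorem comp_mem_idealSpan_right {x y z : C} {f : x ⟶ y} (g : y ⟶ z)
    (hf : f ∈ idealSpan k R x y) : f ≫ g ∈ idealSpan k R x z := by
  have : idealSpan k R x y ≤ (idealSpan k R x z).comap (Linear.rightComp k x g) := by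
    refine Submodule.span_le.2 ?_
    rintro _ ⟨x', y', a, r, b, hr, rfl⟩
    exact Submodule.subset_span ⟨x', y', a, r, b ≫ g, hr, by simp⟩
  exact this hf

instance : Congruence (idealRel k R) where
  equivalence :=
    { refl := fun f => by simp [idealRel]
      symm := fun {f g} h => by
        have := Submodule.neg_mem _ h
        simpa [idealRel] using this
      trans := fun {f g h} h₁ h₂ => by
        have := Submodule.add_mem _ h₁ h₂
        simpa [idealRel] using this }
  comp_left := fun f g g' h => by
    have := comp_mem_idealSpan_left k R f h
    simpa [idealRel] using this
  comp_right := fun g h => by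
    have := comp_mem_idealSpan_right k R g h
    simpa [idealRel] using this

instance : Preadditive (Quotient (idealRel k R)) :=
  Quotient.preadditive _ (fun _ _ f₁ f₂ g₁ g₂ h₁ h₂ => by
    have := Submodule.add_mem _ h₁ h₂
    simpa [idealRel, add_sub_add_comm] using this)

instance : (Quotient.functor (idealRel k R)).Additive where
  map_add := rfl

instance : Linear k (Quotient (idealRel k R)) :=
  Quotient.linear k _ (fun a _ _ f₁ f₂ h => by
    have := Submodule.smul_mem _ a h
    simpa [idealRel, smul_sub] using this)

variable {Q : Type u} [Quiver.{w} Q]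

/-- An arrow of the quiver `Q`, seen in the linear path category `kQ`. -/
def arrow {x y : Q} (e : x ⟶ y) :
    (Free.embedding k (Paths Q)).obj ((Paths.of Q).obj x) ⟶
      (Free.embedding k (Paths Q)).obj ((Paths.of Q).obj y) :=
  (Free.embedding k (Paths Q)).map ((Paths.of Q).map e)

/-- The `n`-th power of the ideal of `kQ` generated by the arrows: linear combinations of paths of
length at least `n`. -/
def arrowPow (n : ℕ) (x y : Paths Q) :
    Submodule k ((Free.embedding k (Paths Q)).obj x ⟶ (Free.embedding k (Paths Q)).obj y) :=
  Submodule.span k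
    { f | ∃ p : x ⟶ y, n ≤ Quiver.Path.length p ∧ f = (Free.embedding k (Paths Q)).map p }

/-- A presentation of the linear category `C` by the quiver `Q`: a full linear functor `kQ ⥤ C`
which is bijective on objects; it identifies `C` with the quotient of `kQ` by the kernel. -/
structure IsPresentation (F : Free k (Paths Q) ⥤ C) : Prop where
  bijective : Function.Bijective F.obj
  additive : F.Additive
  linear : F.Linear k
  full : F.Full

/-- The kernel of the functor is contained in the square of the ideal generated by the arrows. -/
def KernelInSquare (F : Free k (Paths Q) ⥤ C) : Prop :=
  ∀ (x y : Paths Q)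
    (f : (Free.embedding k (Paths Q)).obj x ⟶ (Free.embedding k (Paths Q)).obj y),
    F.map f = 0 → f ∈ arrowPow k 2 x y

/-- Between any two given vertices, the kernel of the functor contains all long enough paths. -/
def KernelHasLongPaths (F : Free k (Paths Q) ⥤ C) : Prop :=
  ∀ x y : Paths Q, ∃ n : ℕ,
    ∀ f ∈ arrowPow k n x y, F.map f = 0

variable (C)

/-- `C` is isomorphic to `kQ / I` for a quiver `Q` and an ideal `I` of `kQ` which is contained in
the square of the ideal generated by the arrows. -/
def HasPresentationInSquare : Prop :=
  ∃ (Q : Type u) (_ : Quiver.{w + 1} Q) (F : Free k (Paths Q) ⥤ C),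
    IsPresentation k F ∧ KernelInSquare k F

/-- `C` is isomorphic to `kQ / I` for a quiver `Q` and an admissible ideal `I` of `kQ`. For a quiver
with infinitely many vertices, the nilpotency condition is imposed locally. -/
def HasAdmissiblePresentation : Prop :=
  ∃ (Q : Type u) (_ : Quiver.{w + 1} Q) (F : Free k (Paths Q) ⥤ C),
    IsPresentation k F ∧ KernelInSquare k F ∧ KernelHasLongPaths k F

end Quotients

/-! ### The infinite ladder -/

/-- The vertices `a i` and `b i` of the infinite ladder. -/
inductive Vertex : Type
  | a (i : ℤ)
  | b (i : ℤ)

/-- The arrows of the infinite ladder. The arrow `α i` goes from `a i` to `b i`, the arrow `γ i`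
from `b i` to `b (i + 1)`, and `β' i` is the arrow usually called `β (i + 1)`, from `a (i + 1)` to
`a i`. -/
inductive Arrow : Vertex → Vertex → Type
  | α (i : ℤ) : Arrow (.a i) (.b i)
  | β' (i : ℤ) : Arrow (.a (i + 1)) (.a i)
  | γ (i : ℤ) : Arrow (.b i) (.b (i + 1))

instance : Quiver Vertex where
  Hom := Arrow

/-- The relators: the path `γ i ∘ α i ∘ β (i + 1)` minus the arrow `α (i + 1)` for `i ≠ 0`, and
the path `γ 0 ∘ α 0 ∘ β 1`. -/
inductive Relator (k : Type z) [Field k] :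
    ∀ ⦃x y : Free k (Paths Vertex)⦄, (x ⟶ y) → Prop
  | nonzero (i : ℤ) (hi : i ≠ 0) :
      Relator k (arrow k (Arrow.β' i : Vertex.a (i + 1) ⟶ Vertex.a i) ≫
        arrow k (Arrow.α i : Vertex.a i ⟶ Vertex.b i) ≫
        arrow k (Arrow.γ i : Vertex.b i ⟶ Vertex.b (i + 1)) -
          arrow k (Arrow.α (i + 1) : Vertex.a (i + 1) ⟶ Vertex.b (i + 1)))
  | zero :
      Relator k (arrow k (Arrow.β' 0 : Vertex.a (0 + 1) ⟶ Vertex.a 0) ≫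
        arrow k (Arrow.α 0 : Vertex.a 0 ⟶ Vertex.b 0) ≫
        arrow k (Arrow.γ 0 : Vertex.b 0 ⟶ Vertex.b (0 + 1)))

/-- The `k`-category of the infinite ladder: the path category of the ladder quiver modulo the ideal
generated by the relators. -/
abbrev Ladder (k : Type z) [Field k] := Quotient (idealRel k (Relator k))

/-- The object `a i` of the ladder category. -/
def Ladder.a (k : Type z) [Field k] (i : ℤ) : Ladder k :=
  (Quotient.functor (idealRel k (Relator k))).obj
    ((Free.embedding k (Paths Vertex)).obj ((Paths.of Vertex).obj (Vertex.a i)))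

/-- The object `b i` of the ladder category. -/
def Ladder.b (k : Type z) [Field k] (i : ℤ) : Ladder k :=
  (Quotient.functor (idealRel k (Relator k))).obj
    ((Free.embedding k (Paths Vertex)).obj ((Paths.of Vertex).obj (Vertex.b i)))

end SchurianLadder

end

/-!
Every path of the ladder from `a i` to `a j`, or from `b i` to `b j`, is unique, and a path from
`a i` to `b j` is determined by the index `m ≤ min i j` of the arrow `α m` that it uses. The
relations identify the paths through `m` and `m + 1` for `m ≠ 0`, and kill the path through `m = 0`
when `i` and `j` are positive. Hence `Ladder.gen x y`, the path with `m = min i j` in the last case,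
generates the space of morphisms (`Ladder.exists_smul_gen`). It is non-zero because there are two
multiplicative weights on paths which vanish on the relators, `Ladder.weightγ` and
`Ladder.weightα`, and one of them takes the value `1` on it. A composite `a i → b j` of generators
is zero exactly when `0 < i`, `0 < j` and the path uses some `α m` with `m ≤ 0`; the statement on
squares follows.

No admissible presentation: in a presentation with kernel inside the square of the arrow ideal, an
arrow is never congruent to a combination of longer paths (`KernelInSquare.map_arrow_ne`). For
`i ≤ 0` the generator `a i → b j` factors through `a (i - 1)`, so no arrow of the presenting quiver
goes from such an `a i` to a vertex `b j`. Therefore no path goes from `a 0` to `b 0`, although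
there is a non-zero morphism.

Gradings: in a Schurian category each space of morphisms is homogeneous, so a grading is a degree
function on pairs of objects which is multiplicative along non-zero composites. The
universal one for the ladder gives degree `1` to `a i → b j` for `0 < i`, `0 < j`, and degree `0` to
the rest. Given another grading, choosing base points along the two horizontal lines and
`α 0` trivializes all degrees but those of `a i → b j` with `0 < i`, `0 < j`, which all become equal
to the degree of the loop around the square of the zero relation (`Ladder.dX_eq`). This
factorization through `ℤ` yields the functors between coverings
(`ConnGrading.isUniversal_of_factorization`), unique because a functor out of a connected
covering is determined on objects by the image of one point
(`IsLift.obj_eq_of_connected`).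

The same uniqueness identifies the groups of two universal gradings, and shows that an automorphism
of the fibre functor is determined by the image of `(c₀, 1)` in the fibre of a universal covering
and that this image is arbitrary (`ConnGrading.IsUniversal.fundamentalGroupEquiv`). The
automorphisms `J` play no role there: they are scalar on each space of morphisms, hence preserve
degrees.
-/

noncomputable section

namespace SchurianLadder

/-! ### Degrees in gradings of Schurian categories -/

section Degrees

variable {k : Type z} [Field k] {C : Type u} [Category.{v} C] [Preadditive C] [Linear k C]

theorem IsSchurian.exists_smul_eq (hS : IsSchurian k C) {x y : C} {f : x ⟶ y} (hf : f ≠ 0)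
    (g : x ⟶ y) : ∃ c : k, c • f = g := by
  rcases hS x y with h | h
  · exact absurd (rank_zero_iff_forall_zero.1 h f) hf
  · exact (finrank_eq_one_iff_of_nonzero' f hf).1
      (Module.finrank_eq_of_rank_eq (n := 1) (by simpa using h)) g

namespace Grading

variable {Γ : Type w} [Group Γ] (X : Grading k C Γ)

theorem degree_unique {x y : C} {f : x ⟶ y} (hf : f ≠ 0) {s t : Γ} (hs : f ∈ X.comp x y s)
    (ht : f ∈ X.comp x y t) : s = t := by
  classical
  by_contra hne
  have hint : DirectSum.IsInternal (X.comp x y) := by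
    convert X.isInternal x y
  have hd := hint.submodule_iSupIndep.pairwiseDisjoint hne
  exact hf (Submodule.disjoint_def.1 hd f hs ht)

/-- In a Schurian category each space of morphisms is homogeneous. -/
theorem exists_degree (hS : IsSchurian k C) (x y : C) : ∃ s : Γ, ∀ f : x ⟶ y, f ∈ X.comp x y s := by
  classical
  by_cases h : ∃ s, ∃ g ∈ X.comp x y s, g ≠ 0
  · obtain ⟨s, g, hg, hne⟩ := h
    refine ⟨s, fun f => ?_⟩
    obtain ⟨c, rfl⟩ := hS.exists_smul_eq hne f
    exact Submodule.smul_mem _ c hg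
  · push Not at h
    have hint : DirectSum.IsInternal (X.comp x y) := by
      convert X.isInternal x y
    have hbot : ∀ s, X.comp x y s = ⊥ := fun s => (Submodule.eq_bot_iff _).2 (h s)
    refine ⟨1, fun f => ?_⟩
    rw [hbot, ← iSup_eq_bot.2 hbot, hint.submodule_iSup_eq_top]
    trivial

/-- The degree of the morphisms from `x` to `y` in a graded Schurian category; it is arbitrary
when there is no non-zero morphism. -/
def degree (hS : IsSchurian k C) (x y : C) : Γ := (X.exists_degree hS x y).choose

theorem mem_degree (hS : IsSchurian k C) {x y : C} (f : x ⟶ y) :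
    f ∈ X.comp x y (X.degree hS x y) :=
  (X.exists_degree hS x y).choose_spec f

theorem eq_degree (hS : IsSchurian k C) {x y : C} {f : x ⟶ y} (hf : f ≠ 0) {s : Γ}
    (hs : f ∈ X.comp x y s) : s = X.degree hS x y :=
  X.degree_unique hf hs (X.mem_degree hS f)

theorem degree_comp (hS : IsSchurian k C) {x y t : C} {f : x ⟶ y} {g : y ⟶ t} (h : f ≫ g ≠ 0) :
    X.degree hS x t = X.degree hS y t * X.degree hS x y :=
  (X.eq_degree hS h (X.comp_mem (X.mem_degree hS f) (X.mem_degree hS g))).symm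

instance : X.proj.Faithful where
  map_injective h := Subtype.ext h

/-- The deck transformation of the covering `C # X ⥤ C` given by left multiplication by `s`. -/
def translate (s : Γ) : Smash X ⥤ Smash X where
  obj p := ⟨p.obj, s * p.deg⟩
  map {p q} f := ⟨f.1, by
    have h : (s * q.deg)⁻¹ * (s * p.deg) = q.deg⁻¹ * p.deg := by group
    simpa only [h] using f.2⟩

end Grading

end Degrees

/-! ### Functors between coverings are determined by the image of one object -/

section Lifts

variable {k : Type z} [Field k] {C : Type u} [Category.{v} C] [Preadditive C] [Linear k C]
variable {Γ Γ' Γ'' : Type w} [Group Γ] [Group Γ'] [Group Γ'']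
variable {U : Grading k C Γ} {X : Grading k C Γ'} {Y : Grading k C Γ''}

/-- A functor between smash products which preserves the underlying objects and sends non-zero
morphisms to non-zero morphisms. The functors `H` in morphisms `(H, J)` of coverings have this
property, which forgets `J`. -/
structure IsLift (H : Grading.Smash U ⥤ Grading.Smash X) : Prop where
  obj_eq : ∀ p, (H.obj p).obj = p.obj
  map_ne : ∀ {p q : Grading.Smash U} (m : p ⟶ q), m.1 ≠ 0 → (H.map m).1 ≠ 0

theorem isLift_of_comm {H : Grading.Smash U ⥤ Grading.Smash X} {J : C ⥤ C}
    (hJ : ∀ x, J.obj x = x) [J.Additive] [J.Faithful] (h : H ⋙ X.proj = U.proj ⋙ J) :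
    IsLift H where
  obj_eq p := (Functor.congr_obj h p).trans (hJ _)
  map_ne {p q} m hm h0 := by
    have h1 := Functor.congr_hom h.symm m
    have h2 : (H ⋙ X.proj).map m = 0 := h0
    rw [h2, Limits.zero_comp, Limits.comp_zero] at h1
    exact hm (J.map_injective (h1.trans (J.map_zero _ _).symm))

theorem isLift_of_comm_id {H : Grading.Smash U ⥤ Grading.Smash X} (h : H ⋙ X.proj = U.proj) :
    IsLift H :=
  isLift_of_comm (J := 𝟭 C) (fun _ => rfl) h

theorem IsLift.comp {H : Grading.Smash U ⥤ Grading.Smash X}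
    {K : Grading.Smash X ⥤ Grading.Smash Y} (hH : IsLift H) (hK : IsLift K) : IsLift (H ⋙ K) where
  obj_eq p := (hK.obj_eq _).trans (hH.obj_eq p)
  map_ne m hm := hK.map_ne _ (hH.map_ne m hm)

theorem isLift_id : IsLift (𝟭 (Grading.Smash U)) :=
  ⟨fun _ => rfl, fun _ hm => hm⟩

theorem isLift_translate (s : Γ) : IsLift (U.translate s) :=
  isLift_of_comm_id rfl

/-- In a Schurian category the degree of `H m` depends only on the ends of `m`, not on `H`. -/
theorem IsLift.deg_eq (hS : IsSchurian k C) {H : Grading.Smash U ⥤ Grading.Smash X}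
    (hH : IsLift H) {p q : Grading.Smash U} (m : p ⟶ q) (hm : m.1 ≠ 0) :
    (H.obj q).deg⁻¹ * (H.obj p).deg = X.degree hS p.obj q.obj := by
  have := X.eq_degree hS (hH.map_ne m hm) (H.map m).2
  rwa [hH.obj_eq, hH.obj_eq] at this

theorem IsLift.obj_eq_iff (hS : IsSchurian k C) {H H' : Grading.Smash U ⥤ Grading.Smash X}
    (hH : IsLift H) (hH' : IsLift H') {p q : Grading.Smash U} (m : p ⟶ q) (hm : m.1 ≠ 0) :
    H.obj p = H'.obj p ↔ H.obj q = H'.obj q := by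
  have h := (hH.deg_eq hS m hm).trans (hH'.deg_eq hS m hm).symm
  constructor <;> intro he
  · refine Grading.Smash.ext ((hH.obj_eq q).trans (hH'.obj_eq q).symm) ?_
    simpa [he] using h
  · refine Grading.Smash.ext ((hH.obj_eq p).trans (hH'.obj_eq p).symm) ?_
    simpa [he] using h

theorem IsLift.obj_eq_of_walk (hS : IsSchurian k C) {H H' : Grading.Smash U ⥤ Grading.Smash X}
    (hH : IsLift H) (hH' : IsLift H') {x y : C} {s : Γ} (hw : U.HomogWalk x y s) (r : Γ)
    (h : H.obj ⟨x, r⟩ = H'.obj ⟨x, r⟩) :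
    H.obj ⟨y, r * s⁻¹⟩ = H'.obj ⟨y, r * s⁻¹⟩ := by
  induction hw with
  | nil => simpa using h
  | @forward y z s t f hf hft p ih =>
    have hm : f ∈ U.comp y z ((r * (t * s)⁻¹)⁻¹ * (r * s⁻¹)) := by
      convert hft using 1; group
    exact (hH.obj_eq_iff hS hH' (p := ⟨y, r * s⁻¹⟩) (q := ⟨z, r * (t * s)⁻¹⟩) ⟨f, hm⟩ hf).1 ih
  | @backward y z s t f hf hft p ih =>
    have hm : f ∈ U.comp z y ((r * s⁻¹)⁻¹ * (r * (t⁻¹ * s)⁻¹)) := by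
      convert hft using 1; group
    exact (hH.obj_eq_iff hS hH' (p := ⟨z, r * (t⁻¹ * s)⁻¹⟩) (q := ⟨y, r * s⁻¹⟩) ⟨f, hm⟩ hf).2 ih

/-- Two functors out of a connected covering which agree on one object agree on all objects. -/
theorem IsLift.obj_eq_of_connected (hS : IsSchurian k C) (hU : U.IsConnected)
    {H H' : Grading.Smash U ⥤ Grading.Smash X} (hH : IsLift H) (hH' : IsLift H')
    {p : Grading.Smash U} (h : H.obj p = H'.obj p) (q : Grading.Smash U) :
    H.obj q = H'.obj q := by
  have := hH.obj_eq_of_walk hS hH' (hU p.obj q.obj (q.deg⁻¹ * p.deg)) p.deg h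
  simpa using this

theorem functor_eq_of_connected (hS : IsSchurian k C) (hU : U.IsConnected)
    {H H' : Grading.Smash U ⥤ Grading.Smash X} (hH : H ⋙ X.proj = U.proj)
    (hH' : H' ⋙ X.proj = U.proj) {p : Grading.Smash U} (h : H.obj p = H'.obj p) : H = H' := by
  have hobj := (isLift_of_comm_id hH).obj_eq_of_connected hS hU (isLift_of_comm_id hH') h
  refine CategoryTheory.Functor.ext hobj fun p q m => X.proj.map_injective ?_
  have := Functor.congr_hom (hH.trans hH'.symm) m
  simpa [eqToHom_map] using this

/-- A grading `U` from which every degree of `X` is obtained by a group morphism `φ`, up to a change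
of base points `g`, has a covering which maps to the covering of `X`. -/
def lift (φ : Γ →* Γ') (g : C → Γ')
    (h : ∀ x y s, U.comp x y s ≤ X.comp x y (g y * φ s * (g x)⁻¹)) (c : Γ') :
    Grading.Smash U ⥤ Grading.Smash X where
  obj p := ⟨p.obj, c * φ p.deg * (g p.obj)⁻¹⟩
  map {p q} f := ⟨f.1, by
    have := h _ _ _ f.2
    have he : g q.obj * φ (q.deg⁻¹ * p.deg) * (g p.obj)⁻¹ =
        (c * φ q.deg * (g q.obj)⁻¹)⁻¹ * (c * φ p.deg * (g p.obj)⁻¹) := by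
      simp [mul_assoc]
    rwa [he] at this⟩

end Lifts

/-! ### Universal gradings and the intrinsic fundamental group -/

namespace ConnGrading

variable {k : Type z} [Field k] {C : Type u} [Category.{v} C] [Preadditive C] [Linear k C]

/-- Criterion for universality: every connected grading of `C` is deduced from `U` by a group
morphism and a change of base points. -/
theorem isUniversal_of_factorization (hS : IsSchurian k C) (U : ConnGrading.{u, v, w, z} k C)
    (hU : ∀ X : ConnGrading.{u, v, w, z} k C, ∃ (φ : U.Γ →* X.Γ) (g : C → X.Γ),
      ∀ x y s, U.grading.comp x y s ≤ X.grading.comp x y (g y * φ s * (g x)⁻¹)) :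
    U.IsUniversal := by
  intro X p q hpq
  obtain ⟨φ, g, h⟩ := hU X
  refine ⟨lift φ g h (q.deg * g p.obj * (φ p.deg)⁻¹), ⟨rfl, ?_⟩, ?_⟩
  · exact Grading.Smash.ext hpq (by simp [lift, mul_assoc])
  · rintro H ⟨h₁, h₂⟩
    refine functor_eq_of_connected hS U.connected h₁ rfl (p := p) (h₂.trans ?_)
    exact Grading.Smash.ext hpq.symm (by simp [lift, mul_assoc])

/-- A functor between coverings which preserves a base point induces a group morphism: compare
the deck transformations at the base point. -/
theorem deg_mul_of_isLift (hS : IsSchurian k C) {U X : ConnGrading.{u, v, w, z} k C}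
    {H : U.Cover ⥤ X.Cover} (hH : IsLift H) {x₀ : C} (h₀ : H.obj ⟨x₀, 1⟩ = ⟨x₀, 1⟩) (s t : U.Γ) :
    (H.obj ⟨x₀, s * t⟩).deg = (H.obj ⟨x₀, s⟩).deg * (H.obj ⟨x₀, t⟩).deg := by
  have key := ((isLift_translate s).comp hH).obj_eq_of_connected hS U.connected
    (hH.comp (isLift_translate (H.obj ⟨x₀, s⟩).deg)) (p := ⟨x₀, 1⟩)
    (Grading.Smash.ext (((isLift_translate s).comp hH).obj_eq _ |>.trans
      ((hH.comp (isLift_translate _)).obj_eq _).symm)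
      (by simp [Grading.translate, h₀])) ⟨x₀, t⟩
  exact congrArg Grading.Smash.deg key

/-- The group of a universal grading is unique up to isomorphism. -/
theorem IsUniversal.nonempty_mulEquiv (hS : IsSchurian k C) [Nonempty C]
    {U V : ConnGrading.{u, v, w, z} k C} (hU : U.IsUniversal) (hV : V.IsUniversal) :
    Nonempty (U.Γ ≃* V.Γ) := by
  obtain ⟨x₀⟩ := ‹Nonempty C›
  obtain ⟨H, ⟨hH, hH0⟩, -⟩ := hU V ⟨x₀, 1⟩ ⟨x₀, 1⟩ rfl
  obtain ⟨K, ⟨hK, hK0⟩, -⟩ := hV U ⟨x₀, 1⟩ ⟨x₀, 1⟩ rfl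
  replace hH := isLift_of_comm_id hH
  replace hK := isLift_of_comm_id hK
  have e₁ : ∀ s, H.obj ⟨x₀, s⟩ = ⟨x₀, (H.obj ⟨x₀, s⟩).deg⟩ :=
    fun s => Grading.Smash.ext (hH.obj_eq _) rfl
  have e₂ : ∀ s, K.obj ⟨x₀, s⟩ = ⟨x₀, (K.obj ⟨x₀, s⟩).deg⟩ :=
    fun s => Grading.Smash.ext (hK.obj_eq _) rfl
  have h₁ := (hH.comp hK).obj_eq_of_connected hS U.connected isLift_id (p := ⟨x₀, 1⟩)
    (by simp [hH0, hK0])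
  have h₂ := (hK.comp hH).obj_eq_of_connected hS V.connected isLift_id (p := ⟨x₀, 1⟩)
    (by simp [hH0, hK0])
  exact ⟨{ toFun := fun s => (H.obj ⟨x₀, s⟩).deg
           invFun := fun s => (K.obj ⟨x₀, s⟩).deg
           left_inv := fun s => by
             have := h₁ ⟨x₀, s⟩
             simp only [Functor.comp_obj, Functor.id_obj] at this
             change (K.obj ⟨x₀, (H.obj ⟨x₀, s⟩).deg⟩).deg = s
             rw [← e₁, this]
           right_inv := fun s => by
             have := h₂ ⟨x₀, s⟩
             simp only [Functor.comp_obj, Functor.id_obj] at this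
             change (H.obj ⟨x₀, (K.obj ⟨x₀, s⟩).deg⟩).deg = s
             rw [← e₂, this]
           map_mul' := deg_mul_of_isLift hS hH hH0 }⟩

/-- The point of degree `s` in the fibre over `c₀`. -/
def fibrePoint (X : ConnGrading.{u, v, w, z} k C) (c₀ : C) (s : X.Γ) : X.Fibre c₀ :=
  ⟨⟨c₀, s⟩, rfl⟩

theorem eq_fibrePoint {X : ConnGrading.{u, v, w, z} k C} {c₀ : C} (p : X.Fibre c₀) :
    p = X.fibrePoint c₀ p.1.deg :=
  Subtype.ext (Grading.Smash.ext p.2 rfl)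

/-- The functor from a universal covering `C # U` to `C # X` sending `(c₀, 1)` to `q`. -/
def IsUniversal.lift {U : ConnGrading.{u, v, w, z} k C} (hU : U.IsUniversal)
    {X : ConnGrading.{u, v, w, z} k C} {c₀ : C} (q : X.Fibre c₀) : U.Cover ⥤ X.Cover :=
  (hU X ⟨c₀, 1⟩ q.1 q.2.symm).choose

section

variable {U : ConnGrading.{u, v, w, z} k C} (hU : U.IsUniversal)
  {X : ConnGrading.{u, v, w, z} k C} {c₀ : C} (q : X.Fibre c₀)

theorem IsUniversal.lift_comm : hU.lift q ⋙ X.proj = U.proj :=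
  (hU X ⟨c₀, 1⟩ q.1 q.2.symm).choose_spec.1.1

theorem IsUniversal.lift_obj : (hU.lift q).obj ⟨c₀, 1⟩ = q.1 :=
  (hU X ⟨c₀, 1⟩ q.1 q.2.symm).choose_spec.1.2

theorem IsUniversal.isLift_lift : IsLift (hU.lift q) :=
  isLift_of_comm_id (hU.lift_comm q)

end

/-- A functor between coverings over the identity of `C`, as a morphism of coverings. -/
def homOfComm {U X : ConnGrading.{u, v, w, z} k C} (H : U.Cover ⥤ X.Cover)
    (h : H ⋙ X.proj = U.proj) : U ⟶ X :=
  { H := H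
    J := 𝟭 C
    obj_eq := fun _ => rfl
    additive := inferInstance
    linear := inferInstance
    full := inferInstance
    faithful := inferInstance
    comm := h }

theorem Hom.isLift {X Y : ConnGrading.{u, v, w, z} k C} (a : Hom X Y) : IsLift a.H := by
  have := a.additive
  have := a.faithful
  exact isLift_of_comm a.obj_eq a.comm

/-- An element `s` of the group of a universal grading acts on all fibres: it sends `q` to the image
of `(c₀, s)` under the functor sending `(c₀, 1)` to `q`. Naturality holds for the morphisms
`(H, J)` with any `J`, as functors between coverings of a Schurian category are determined on
objects by the image of one point. -/
def shift (hS : IsSchurian k C) {U : ConnGrading.{u, v, w, z} k C} (hU : U.IsUniversal) (c₀ : C)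
    (s : U.Γ) : fibreFunctor.{u, v, w, z} k c₀ ⟶ fibreFunctor.{u, v, w, z} k c₀ where
  app X := ↾fun q : X.Fibre c₀ =>
    (⟨(hU.lift q).obj ⟨c₀, s⟩, (hU.isLift_lift q).obj_eq _⟩ : X.Fibre c₀)
  naturality X Y a := by
    ext q
    refine Subtype.ext ?_
    refine (hU.isLift_lift _).obj_eq_of_connected hS U.connected
      ((hU.isLift_lift q).comp (Hom.isLift a)) (p := ⟨c₀, 1⟩) ?_ ⟨c₀, s⟩
    exact (hU.lift_obj _).trans (congrArg a.H.obj (hU.lift_obj q)).symm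

theorem shift_one (hS : IsSchurian k C) {U : ConnGrading.{u, v, w, z} k C} (hU : U.IsUniversal)
    (c₀ : C) : shift hS hU c₀ 1 = 𝟙 _ := by
  ext X q
  exact Subtype.ext (hU.lift_obj q)

theorem shift_comp (hS : IsSchurian k C) {U : ConnGrading.{u, v, w, z} k C} (hU : U.IsUniversal)
    (c₀ : C) (s t : U.Γ) : shift hS hU c₀ s ≫ shift hS hU c₀ t = shift hS hU c₀ (s * t) := by
  ext X q
  refine Subtype.ext ?_
  have := (hU.isLift_lift ((shift hS hU c₀ s).app X q)).obj_eq_of_connected hS U.connected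
    ((isLift_translate s).comp (hU.isLift_lift q)) (p := ⟨c₀, 1⟩) (by
      refine (hU.lift_obj _).trans ?_
      change (hU.lift q).obj ⟨c₀, s⟩ = (hU.lift q).obj ⟨c₀, s * 1⟩
      rw [mul_one]) ⟨c₀, t⟩
  exact this

/-- The automorphism of the fibre functor given by an element of the group of a universal
grading. -/
def shiftAut (hS : IsSchurian k C) {U : ConnGrading.{u, v, w, z} k C} (hU : U.IsUniversal)
    (c₀ : C) (s : U.Γ) : IntrinsicFundamentalGroup.{u, v, w, z} k c₀ where
  hom := shift hS hU c₀ s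
  inv := shift hS hU c₀ s⁻¹
  hom_inv_id := by rw [shift_comp, mul_inv_cancel, shift_one]
  inv_hom_id := by rw [shift_comp, inv_mul_cancel, shift_one]

/-- An automorphism of the fibre functor is determined by the image of `(c₀, 1)` in the fibre of a
universal covering. -/
theorem aut_apply {U : ConnGrading.{u, v, w, z} k C} (hU : U.IsUniversal)
    {c₀ : C} (σ : IntrinsicFundamentalGroup.{u, v, w, z} k c₀)
    (X : ConnGrading.{u, v, w, z} k C) (q : X.Fibre c₀) :
    (σ.hom.app X q : X.Fibre c₀).1 =
      (hU.lift q).obj (σ.hom.app U (U.fibrePoint c₀ 1) : U.Fibre c₀).1 := by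
  have h := NatTrans.naturality_apply σ.hom (homOfComm (hU.lift q) (hU.lift_comm q))
    (U.fibrePoint c₀ 1)
  have hq : (fibreFunctor k c₀).map (homOfComm (hU.lift q) (hU.lift_comm q))
      (U.fibrePoint c₀ 1) = q := Subtype.ext (hU.lift_obj q)
  rw [hq] at h
  rw [h]
  rfl

/-- An automorphism of the fibre functor commutes with the deck transformations. -/
theorem aut_fibrePoint {U : ConnGrading.{u, v, w, z} k C}
    {c₀ : C} (σ : IntrinsicFundamentalGroup.{u, v, w, z} k c₀) (t : U.Γ) :
    (σ.hom.app U (U.fibrePoint c₀ t) : U.Fibre c₀).1.deg =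
      t * (σ.hom.app U (U.fibrePoint c₀ 1) : U.Fibre c₀).1.deg := by
  have h := NatTrans.naturality_apply σ.hom (homOfComm (U.grading.translate t) rfl)
    (U.fibrePoint c₀ 1)
  have hq : (fibreFunctor k c₀).map (homOfComm (U.grading.translate t) rfl)
      (U.fibrePoint c₀ 1) = U.fibrePoint c₀ t :=
    Subtype.ext (Grading.Smash.ext rfl (mul_one t))
  rw [hq] at h
  rw [h]
  rfl

/-- The intrinsic fundamental group of a Schurian category is the opposite of the group of a
universal grading. -/
def IsUniversal.fundamentalGroupEquiv (hS : IsSchurian k C) {U : ConnGrading.{u, v, w, z} k C}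
    (hU : U.IsUniversal) (c₀ : C) : IntrinsicFundamentalGroup.{u, v, w, z} k c₀ ≃* U.Γᵐᵒᵖ :=
  MulEquiv.ofBijective
    (MulHom.mk (fun σ : IntrinsicFundamentalGroup.{u, v, w, z} k c₀ =>
      MulOpposite.op (σ.hom.app U (U.fibrePoint c₀ 1) : U.Fibre c₀).1.deg) (fun σ τ => by
        refine congrArg MulOpposite.op (Eq.trans ?_ (aut_fibrePoint σ _))
        exact congrArg (fun p : U.Fibre c₀ => (σ.hom.app U p : U.Fibre c₀).1.deg)
          (eq_fibrePoint (τ.hom.app U (U.fibrePoint c₀ 1) : U.Fibre c₀))))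
    ⟨fun σ τ h => by
      have h' : (σ.hom.app U (U.fibrePoint c₀ 1) : U.Fibre c₀) =
          τ.hom.app U (U.fibrePoint c₀ 1) := by
        rw [eq_fibrePoint (σ.hom.app U (U.fibrePoint c₀ 1) : U.Fibre c₀),
          eq_fibrePoint (τ.hom.app U (U.fibrePoint c₀ 1) : U.Fibre c₀)]
        exact congrArg _ (MulOpposite.op_injective h)
      ext X q
      refine Subtype.ext ?_
      exact (aut_apply hU σ X q).trans ((by rw [h'] : _ = _).trans (aut_apply hU τ X q).symm),
    fun s => ⟨shiftAut hS hU c₀ s.unop, by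
      refine MulOpposite.unop_injective ?_
      have : (hU.lift (U.fibrePoint c₀ 1)) = 𝟭 _ :=
        functor_eq_of_connected hS U.connected (hU.lift_comm _) rfl (p := ⟨c₀, 1⟩) (hU.lift_obj _)
      change ((hU.lift (U.fibrePoint c₀ 1)).obj ⟨c₀, s.unop⟩).deg = s.unop
      rw [this]
      rfl⟩⟩

end ConnGrading

/-! ### Linear functionals on path categories -/

section PathCategory

variable (k : Type z) [Field k] {D : Type u} [Category.{v} D]

theorem free_induction {x y : D}
    {P : ((Free.embedding k D).obj x ⟶ (Free.embedding k D).obj y) → Prop}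
    (emb : ∀ p : x ⟶ y, P ((Free.embedding k D).map p)) (zero : P 0)
    (add : ∀ f g, P f → P g → P (f + g)) (smul : ∀ (c : k) f, P f → P (c • f))
    (f : (Free.embedding k D).obj x ⟶ (Free.embedding k D).obj y) : P f := by
  refine Finsupp.induction_linear (motive := P) f zero add fun p c => ?_
  have h : (Finsupp.single p c : (x ⟶ y) →₀ k) = c • Finsupp.single p 1 := by
    refine (Finsupp.smul_single c p (1 : k)).trans ?_ |>.symm
    rw [smul_eq_mul, mul_one]
    rfl
  exact h ▸ smul c _ (emb p)

/-- The linear functional on a space of morphisms of the linearization of `D` with prescribed values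
on the morphisms of `D`. -/
def freeEval {x y : D} (φ : (x ⟶ y) → k) :
    ((Free.embedding k D).obj x ⟶ (Free.embedding k D).obj y) →ₗ[k] k where
  toFun f := Finsupp.linearCombination k φ f
  map_add' f g := map_add (Finsupp.linearCombination k φ) f g
  map_smul' c f := map_smul (Finsupp.linearCombination k φ) c f

theorem freeEval_map {x y : D} (φ : (x ⟶ y) → k) (p : x ⟶ y) :
    freeEval k φ ((Free.embedding k D).map p) = φ p := by
  refine (Finsupp.linearCombination_single k (1 : k) p).trans ?_
  rw [one_smul]

end PathCategory

/-! ### Morphisms of the ladder category -/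

namespace Ladder

variable (k : Type z) [Field k]

/-- The object of the ladder category given by a vertex. -/
def obj (x : Vertex) : Ladder k :=
  (Quotient.functor (idealRel k (Relator k))).obj
    ((Free.embedding k (Paths Vertex)).obj ((Paths.of Vertex).obj x))

/-- The morphism of the ladder category given by a path. -/
def pathMor {x y : Vertex} (p : Quiver.Path x y) : obj k x ⟶ obj k y :=
  (Quotient.functor (idealRel k (Relator k))).map ((Free.embedding k (Paths Vertex)).map p)

theorem pathMor_nil (x : Vertex) : pathMor k (Quiver.Path.nil : Quiver.Path x x) = 𝟙 _ := by
  exact (congrArg _ ((Free.embedding k (Paths Vertex)).map_id x)).trans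
    ((Quotient.functor (idealRel k (Relator k))).map_id _)

theorem pathMor_comp {x y t : Vertex} (p : Quiver.Path x y) (q : Quiver.Path y t) :
    pathMor k (p.comp q) = pathMor k p ≫ pathMor k q := by
  exact (congrArg _
    ((Free.embedding k (Paths Vertex)).map_comp (X := x) (Y := y) (Z := t) p q)).trans
    ((Quotient.functor (idealRel k (Relator k))).map_comp _ _)

theorem pathMor_cons {x y t : Vertex} (p : Quiver.Path x y) (e : y ⟶ t) :
    pathMor k (p.cons e) = pathMor k p ≫ pathMor k e.toPath :=
  pathMor_comp k p e.toPath

/-- Every morphism is a linear combination of paths. -/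
theorem mor_induction {x y : Vertex} {P : (obj k x ⟶ obj k y) → Prop}
    (path : ∀ p : Quiver.Path x y, P (pathMor k p)) (zero : P 0)
    (add : ∀ f g, P f → P g → P (f + g)) (smul : ∀ (c : k) f, P f → P (c • f))
    (f : obj k x ⟶ obj k y) : P f := by
  obtain ⟨f, rfl⟩ := (Quotient.functor (idealRel k (Relator k))).map_surjective f
  exact free_induction k (P := fun f => P ((Quotient.functor (idealRel k (Relator k))).map f))
    path zero (fun f g => add _ _) (fun c f => smul c _) f

theorem map_eq_zero_iff {x y : Free k (Paths Vertex)} (f : x ⟶ y) :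
    (Quotient.functor (idealRel k (Relator k))).map f = 0 ↔ f ∈ idealSpan k (Relator k) x y := by
  rw [← Functor.map_zero (Quotient.functor (idealRel k (Relator k))),
    Quotient.functor_map_eq_iff]
  simp [idealRel]

theorem relator_eq_zero {x y : Free k (Paths Vertex)} {f : x ⟶ y} (hf : Relator k f) :
    (Quotient.functor (idealRel k (Relator k))).map f = 0 :=
  (map_eq_zero_iff k f).2 (Submodule.subset_span ⟨x, y, 𝟙 x, f, 𝟙 y, hf, by simp⟩)

/-- The morphism given by the arrow `α i`. -/
def α (i : ℤ) : obj k (.a i) ⟶ obj k (.b i) :=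
  pathMor k (Quiver.Hom.toPath (Arrow.α i : Vertex.a i ⟶ Vertex.b i))

/-- The morphism given by the arrow from `a (i + 1)` to `a i`. -/
def β (i : ℤ) : obj k (.a (i + 1)) ⟶ obj k (.a i) :=
  pathMor k (Quiver.Hom.toPath (Arrow.β' i : Vertex.a (i + 1) ⟶ Vertex.a i))

/-- The morphism given by the arrow `γ i`. -/
def γ (i : ℤ) : obj k (.b i) ⟶ obj k (.b (i + 1)) :=
  pathMor k (Quiver.Hom.toPath (Arrow.γ i : Vertex.b i ⟶ Vertex.b (i + 1)))

theorem relation_of_ne {i : ℤ} (hi : i ≠ 0) : β k i ≫ α k i ≫ γ k i = α k (i + 1) := by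
  have h := relator_eq_zero k (Relator.nonzero i hi)
  rw [Functor.map_sub, sub_eq_zero, Functor.map_comp, Functor.map_comp] at h
  exact h

theorem relation_zero : β k 0 ≫ α k 0 ≫ γ k 0 = 0 := by
  have h := relator_eq_zero k Relator.zero
  rw [Functor.map_comp, Functor.map_comp] at h
  exact h

/-! ### Non-vanishing of paths -/

/-- The multiplicative extension to paths of a family of weights on arrows. -/
def pathWeight (ω : ∀ x y : Vertex, Arrow x y → k) {x : Vertex} :
    ∀ {y : Vertex}, Quiver.Path x y → k
  | _, .nil => 1
  | _, .cons p e => pathWeight ω p * ω _ _ e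

theorem pathWeight_comp (ω : ∀ x y : Vertex, Arrow x y → k) {x y t : Vertex}
    (p : Quiver.Path x y) (q : Quiver.Path y t) :
    pathWeight k ω (p.comp q) = pathWeight k ω p * pathWeight k ω q := by
  induction q with
  | nil => simp [pathWeight]
  | cons q e ih => simp [pathWeight, ih, mul_assoc]

theorem pathWeight_toPath (ω : ∀ x y : Vertex, Arrow x y → k) {x y : Vertex} (e : x ⟶ y) :
    pathWeight k ω e.toPath = ω x y e :=
  one_mul _

/-- The linear extension of `pathWeight` to linear combinations of paths. -/
def weight (ω : ∀ x y : Vertex, Arrow x y → k) {x y : Free k (Paths Vertex)} : (x ⟶ y) →ₗ[k] k :=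
  freeEval k (D := Paths Vertex) (x := x) (y := y) (fun p => pathWeight k ω p)

theorem weight_map (ω : ∀ x y : Vertex, Arrow x y → k) {x y : Vertex} (p : Quiver.Path x y) :
    weight k ω ((Free.embedding k (Paths Vertex)).map p) = pathWeight k ω p :=
  freeEval_map k (D := Paths Vertex) (fun p => pathWeight k ω p) p

theorem weight_comp_embedding (ω : ∀ x y : Vertex, Arrow x y → k) {x y t : Paths Vertex}
    (f : (Free.embedding k (Paths Vertex)).obj x ⟶ (Free.embedding k (Paths Vertex)).obj y)
    (g : (Free.embedding k (Paths Vertex)).obj y ⟶ (Free.embedding k (Paths Vertex)).obj t) :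
    weight k ω (f ≫ g) = weight k ω f * weight k ω g := by
  refine free_induction k (P := fun f => weight k ω (f ≫ g) = weight k ω f * weight k ω g)
    (fun p => ?_) ?_ ?_ ?_ f
  · refine free_induction k
      (P := fun g => weight k ω ((Free.embedding k (Paths Vertex)).map p ≫ g) =
        weight k ω ((Free.embedding k (Paths Vertex)).map p) * weight k ω g)
      (fun q => ?_) ?_ ?_ ?_ g
    · rw [← Functor.map_comp]
      refine (weight_map k ω (p.comp q)).trans ((pathWeight_comp k ω p q).trans ?_)
      exact (congrArg₂ (· * ·) (weight_map k ω p) (weight_map k ω q)).symm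
    · rw [Limits.comp_zero, map_zero, map_zero, mul_zero]
    · intro f g hf hg
      rw [Preadditive.comp_add, map_add, map_add, hf, hg, mul_add]
    · intro c f hf
      rw [Linear.comp_smul, map_smul, map_smul, hf, smul_eq_mul, smul_eq_mul, mul_left_comm]
  · simp
  · intro f g hf hg
    rw [Preadditive.add_comp, map_add, map_add, hf, hg, add_mul]
  · intro c f hf
    rw [Linear.smul_comp, map_smul, map_smul, hf, smul_eq_mul, smul_eq_mul, mul_assoc]

theorem weight_comp (ω : ∀ x y : Vertex, Arrow x y → k) {x y t : Free k (Paths Vertex)}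
    (f : x ⟶ y) (g : y ⟶ t) : weight k ω (f ≫ g) = weight k ω f * weight k ω g :=
  weight_comp_embedding k ω (x := x) (y := y) (t := t) f g

/-- A path of non-zero weight is non-zero in the ladder category as soon as the weight vanishes on
the relators. -/
theorem pathMor_ne_zero {ω : ∀ x y : Vertex, Arrow x y → k}
    (hω : ∀ ⦃x y : Free k (Paths Vertex)⦄ (r : x ⟶ y), Relator k r → weight k ω r = 0)
    {x y : Vertex} {p : Quiver.Path x y} (hp : pathWeight k ω p ≠ 0) : pathMor k p ≠ 0 := by
  intro h
  have hmem := (map_eq_zero_iff k _).1 h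
  have hker : ∀ x y : Free k (Paths Vertex),
      idealSpan k (Relator k) x y ≤ LinearMap.ker (weight k ω) := by
    intro x y
    refine Submodule.span_le.2 ?_
    rintro _ ⟨x', y', f, r, g, hr, rfl⟩
    have h : weight k ω (f ≫ r ≫ g) = 0 := by
      rw [weight_comp, weight_comp, hω r hr, zero_mul, mul_zero]
    exact h
  refine hp ?_
  rw [← weight_map]
  exact hker _ _ hmem

/-- The weight with value `0` on `γ 0` and `1` on all other arrows. -/
def weightγ : ∀ x y : Vertex, Arrow x y → k
  | _, _, .α _ => 1
  | _, _, .β' _ => 1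
  | _, _, .γ i => if i = 0 then 0 else 1

/-- The weight with value `0` on the arrows starting at `a i` for `i` positive, and `1` on all
other arrows. -/
def weightα : ∀ x y : Vertex, Arrow x y → k
  | _, _, .α i => if i ≤ 0 then 1 else 0
  | _, _, .β' i => if i + 1 ≤ 0 then 1 else 0
  | _, _, .γ _ => 1

theorem weight_arrow (ω : ∀ x y : Vertex, Arrow x y → k) {x y : Vertex} (e : x ⟶ y) :
    weight k ω (arrow k e) = ω x y e :=
  (weight_map k ω e.toPath).trans (pathWeight_toPath k ω e)

theorem weightγ_relator ⦃x y : Free k (Paths Vertex)⦄ (r : x ⟶ y) (hr : Relator k r) :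
    weight k (weightγ k) r = 0 := by
  cases hr with
  | nonzero i hi => rw [map_sub, weight_comp, weight_comp]; simp [weight_arrow, weightγ, hi]
  | zero => rw [weight_comp, weight_comp]; simp [weight_arrow, weightγ]

theorem weightα_relator ⦃x y : Free k (Paths Vertex)⦄ (r : x ⟶ y) (hr : Relator k r) :
    weight k (weightα k) r = 0 := by
  cases hr with
  | nonzero i hi =>
    rw [map_sub, weight_comp, weight_comp]
    by_cases h : i + 1 ≤ 0
    · simp [weight_arrow, weightα, h, show i ≤ 0 by omega]
    · simp [weight_arrow, weightα, h]
  | zero => rw [weight_comp, weight_comp]; simp [weight_arrow, weightα]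

/-! ### Horizontal paths and crossing paths -/

/-- The path of length `n` from `a i` to `a j`. -/
def aPath (i : ℤ) : ∀ (n : ℕ) (j : ℤ), i = j + n → Quiver.Path (Vertex.a i) (Vertex.a j)
  | 0, j, h => (show i = j by simpa using h) ▸ Quiver.Path.nil
  | n + 1, j, h => (aPath i n (j + 1) (by push_cast at h; omega)).cons
      (Arrow.β' j : Vertex.a (j + 1) ⟶ Vertex.a j)

/-- The path of length `n` from `b i` to `b j`. -/
def bPath (j : ℤ) : ∀ (n : ℕ) (i : ℤ), j = i + n → Quiver.Path (Vertex.b i) (Vertex.b j)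
  | 0, i, h => (show j = i by simpa using h) ▸ Quiver.Path.nil
  | n + 1, i, h => (Quiver.Hom.toPath (Arrow.γ i : Vertex.b i ⟶ Vertex.b (i + 1))).comp
      (bPath j n (i + 1) (by push_cast at h; omega))

theorem pathWeight_aPath (ω : ∀ x y : Vertex, Arrow x y → k) (i : ℤ)
    (hω : ∀ m < i, ω _ _ (Arrow.β' m) = 1) (n : ℕ) (j : ℤ) (h : i = j + n) :
    pathWeight k ω (aPath i n j h) = 1 := by
  induction n generalizing j with
  | zero => obtain rfl : i = j := by simpa using h
            rfl
  | succ n ih =>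
    simp only [aPath, pathWeight]
    rw [ih, one_mul]
    exact hω _ (by omega)

theorem pathWeight_bPath (ω : ∀ x y : Vertex, Arrow x y → k) (j : ℤ) (n : ℕ) (i : ℤ)
    (h : j = i + n) (hω : ∀ m, i ≤ m → m < j → ω _ _ (Arrow.γ m) = 1) :
    pathWeight k ω (bPath j n i h) = 1 := by
  induction n generalizing i with
  | zero => obtain rfl : j = i := by simpa using h
            rfl
  | succ n ih =>
    simp only [bPath]
    rw [pathWeight_comp, pathWeight_toPath, ih, mul_one]
    · exact hω _ le_rfl (by omega)
    · exact fun m hm => hω m (by omega)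

/-- The morphism from `a i` to `a j` for `j ≤ i`. -/
def A {i j : ℤ} (h : j ≤ i) : obj k (.a i) ⟶ obj k (.a j) :=
  pathMor k (aPath i (i - j).toNat j (by omega))

/-- The morphism from `b i` to `b j` for `i ≤ j`. -/
def B {i j : ℤ} (h : i ≤ j) : obj k (.b i) ⟶ obj k (.b j) :=
  pathMor k (bPath j (j - i).toNat i (by omega))

theorem A_eq {i j : ℤ} (h : j ≤ i) (n : ℕ) (hn : i = j + n) :
    A k h = pathMor k (aPath i n j hn) := by
  obtain rfl : n = (i - j).toNat := by omega
  rfl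

theorem B_eq {i j : ℤ} (h : i ≤ j) (n : ℕ) (hn : j = i + n) :
    B k h = pathMor k (bPath j n i hn) := by
  obtain rfl : n = (j - i).toNat := by omega
  rfl

theorem A_self (i : ℤ) : A k (le_refl i) = 𝟙 _ :=
  (A_eq k le_rfl 0 (by simp)).trans (pathMor_nil k _)

theorem B_self (i : ℤ) : B k (le_refl i) = 𝟙 _ :=
  (B_eq k le_rfl 0 (by simp)).trans (pathMor_nil k _)

theorem A_succ {i j : ℤ} (h : j + 1 ≤ i) (h' : j ≤ i) : A k h' = A k h ≫ β k j := by
  obtain ⟨n, hn⟩ := Int.le.dest h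
  rw [A_eq k h' (n + 1) (by push_cast; omega), A_eq k h n hn.symm]
  exact pathMor_cons k _ _

theorem B_succ {i j : ℤ} (h : i + 1 ≤ j) (h' : i ≤ j) : B k h' = γ k i ≫ B k h := by
  obtain ⟨n, hn⟩ := Int.le.dest h
  rw [B_eq k h' (n + 1) (by push_cast; omega), B_eq k h n hn.symm]
  exact pathMor_comp k _ _

theorem A_comp {i j m : ℤ} (h : j ≤ i) (h' : m ≤ j) : A k h ≫ A k h' = A k (h'.trans h) := by
  obtain ⟨n, hn⟩ := Int.le.dest h'
  induction n generalizing m with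
  | zero => obtain rfl : m = j := by simpa using hn
            rw [A_self, Category.comp_id]
  | succ n ih =>
    have h₁ : m + 1 ≤ j := by omega
    rw [A_succ k h₁, A_succ k (h₁.trans h), ← Category.assoc, ih h₁ (by push_cast at hn; omega)]

theorem B_comp {i j m : ℤ} (h : i ≤ j) (h' : j ≤ m) : B k h ≫ B k h' = B k (h.trans h') := by
  obtain ⟨n, hn⟩ := Int.le.dest h
  induction n generalizing i with
  | zero => obtain rfl : i = j := by simpa using hn
            rw [B_self, Category.id_comp]
  | succ n ih =>
    have h₁ : i + 1 ≤ j := by omega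
    rw [B_succ k h₁, B_succ k (h₁.trans h'), Category.assoc, ih h₁ (by push_cast at hn; omega)]

theorem B_one (i : ℤ) (h : i ≤ i + 1) : B k h = γ k i := by
  rw [B_succ k le_rfl, B_self, Category.comp_id]

/-- The morphism from `a i` to `b j` given by the path through `a m → b m`, for `m ≤ i` and
`m ≤ j`. -/
def cross {i j m : ℤ} (h : m ≤ i) (h' : m ≤ j) : obj k (.a i) ⟶ obj k (.b j) :=
  A k h ≫ α k m ≫ B k h'

theorem cross_succ {i j m : ℤ} (h : m + 1 ≤ i) (h' : m + 1 ≤ j) (h₁ : m ≤ i) (h₂ : m ≤ j)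
    (hm : m ≠ 0) : cross k h₁ h₂ = cross k h h' := by
  rw [cross, cross, A_succ k h, B_succ k h', ← relation_of_ne k hm]
  simp only [Category.assoc]

/-- The crossing path through `α 0` contains the zero relation when its ends have positive
indices. -/
theorem cross_zero {i j : ℤ} (hi : 0 < i) (hj : 0 < j) : cross k hi.le hj.le = 0 := by
  have h := relation_zero k
  rw [cross, A_succ k (show 0 + 1 ≤ i by omega), B_succ k (show 0 + 1 ≤ j by omega)]
  have e : ∀ (f : obj k (.a i) ⟶ obj k (.a (0 + 1))) (g : obj k (.b (0 + 1)) ⟶ obj k (.b j)),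
      (f ≫ β k 0) ≫ α k 0 ≫ γ k 0 ≫ g = f ≫ (β k 0 ≫ α k 0 ≫ γ k 0) ≫ g := by
    intro f g
    simp only [Category.assoc]
  rw [e, h, Limits.zero_comp, Limits.comp_zero]

/-- Two crossing paths which are not separated by the zero relation are equal. -/
theorem cross_eq {i j m m' : ℤ} (h : m ≤ i) (h' : m ≤ j) (h₁ : m' ≤ i) (h₂ : m' ≤ j)
    (hm : m ≤ m') (hsep : 0 < m ∨ m' ≤ 0) : cross k h h' = cross k h₁ h₂ := by
  obtain ⟨n, hn⟩ := Int.le.dest hm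
  induction n generalizing m with
  | zero => obtain rfl : m = m' := by simpa using hn
            rfl
  | succ n ih =>
    push_cast at hn
    rw [cross_succ k (m := m) (by omega) (by omega) h h' (by omega)]
    exact ih _ _ (by omega) (by omega) (by omega)

theorem cross_eq_zero {i j m : ℤ} (h : m ≤ i) (h' : m ≤ j) (hm : m ≤ 0) (hi : 0 < i) (hj : 0 < j) :
    cross k h h' = 0 := by
  rw [cross_eq k h h' hi.le hj.le hm (Or.inr le_rfl), cross_zero k hi hj]

theorem pathWeight_A_α_B (ω : ∀ x y : Vertex, Arrow x y → k) {i j m : ℤ}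
    (p : Quiver.Path (Vertex.a i) (Vertex.a m)) (q : Quiver.Path (Vertex.b m) (Vertex.b j))
    (hp : pathWeight k ω p = 1) (hq : pathWeight k ω q = 1) (hα : ω _ _ (Arrow.α m) = 1) :
    pathWeight k ω
      (p.comp ((Quiver.Hom.toPath (Arrow.α m : Vertex.a m ⟶ Vertex.b m)).comp q)) = 1 := by
  rw [pathWeight_comp, pathWeight_comp, pathWeight_toPath, hp, hq, hα, one_mul, one_mul]

/-- The weight `weightγ` detects the paths which avoid `γ 0`. -/
theorem A_ne_zero {i j : ℤ} (h : j ≤ i) : A k h ≠ 0 := by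
  refine pathMor_ne_zero k (weightγ_relator k) ?_
  rw [pathWeight_aPath]
  · exact one_ne_zero
  · exact fun _ _ => rfl

/-- The weight `weightα` detects the paths which avoid the arrows starting at the vertices `a i`
with `i` positive. -/
theorem B_ne_zero {i j : ℤ} (h : i ≤ j) : B k h ≠ 0 := by
  refine pathMor_ne_zero k (weightα_relator k) ?_
  rw [pathWeight_bPath]
  · exact one_ne_zero
  · exact fun _ _ _ => rfl

/-- The crossing paths from `a i` with `i ≤ 0` are detected by `weightα`; for `0 < i`, the
hypothesis ensures that the path avoids `γ 0`, and `weightγ` detects it. -/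
theorem cross_ne_zero {i j m : ℤ} (h : m ≤ i) (h' : m ≤ j) (hm : 0 < m ∨ i ≤ 0 ∨ j ≤ 0) :
    cross k h h' ≠ 0 := by
  rw [cross, A, B, α, ← pathMor_comp, ← pathMor_comp]
  by_cases hi : i ≤ 0
  · refine pathMor_ne_zero k (weightα_relator k) ?_
    rw [pathWeight_A_α_B]
    · exact one_ne_zero
    · exact pathWeight_aPath _ _ _ (fun m hm => if_pos (by omega)) _ _ _
    · exact pathWeight_bPath _ _ _ _ _ _ (fun _ _ _ => rfl)
    · exact if_pos (by omega)
  · refine pathMor_ne_zero k (weightγ_relator k) ?_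
    rw [pathWeight_A_α_B]
    · exact one_ne_zero
    · exact pathWeight_aPath _ _ _ (fun _ _ => rfl) _ _ _
    · exact pathWeight_bPath _ _ _ _ _ _ (fun _ _ _ => if_neg (by omega))
    · rfl

/-! ### The ladder category is Schurian -/

/-- The generator of the space of morphisms between two objects. It is zero exactly when there is
no path from `x` to `y`. -/
def gen : ∀ x y : Vertex, obj k x ⟶ obj k y
  | .a i, .a j => if h : j ≤ i then A k h else 0
  | .b i, .b j => if h : i ≤ j then B k h else 0
  | .a i, .b j => cross k (min_le_left i j) (min_le_right i j)
  | .b _, .a _ => 0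

theorem gen_aa {i j : ℤ} (h : j ≤ i) : gen k (.a i) (.a j) = A k h := dif_pos h

theorem gen_bb {i j : ℤ} (h : i ≤ j) : gen k (.b i) (.b j) = B k h := dif_pos h

theorem gen_ab_ne_zero (i j : ℤ) : gen k (.a i) (.b j) ≠ 0 :=
  cross_ne_zero k _ _ (by omega)

theorem cross_eq_gen {i j m : ℤ} (h : m ≤ i) (h' : m ≤ j) (hm : 0 < m ∨ i ≤ 0 ∨ j ≤ 0) :
    cross k h h' = gen k (.a i) (.b j) :=
  cross_eq k _ _ _ _ (by omega) (by omega)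

theorem cross_eq_zero_or_gen {i j m : ℤ} (h : m ≤ i) (h' : m ≤ j) :
    cross k h h' = 0 ∨ cross k h h' = gen k (.a i) (.b j) := by
  by_cases hm : 0 < m ∨ i ≤ 0 ∨ j ≤ 0
  · exact Or.inr (cross_eq_gen k h h' hm)
  · exact Or.inl (cross_eq_zero k h h' (by omega) (by omega) (by omega))

/-- The normal form of the morphisms given by paths. -/
inductive IsNormal : ∀ {x y : Vertex}, (obj k x ⟶ obj k y) → Prop
  | aa {i j : ℤ} (h : j ≤ i) : IsNormal (A k h)
  | bb {i j : ℤ} (h : i ≤ j) : IsNormal (B k h)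
  | ab {i j m : ℤ} (h : m ≤ i) (h' : m ≤ j) : IsNormal (cross k h h')

theorem IsNormal.comp_arrow {x y t : Vertex} {f : obj k x ⟶ obj k y} (hf : IsNormal k f)
    (e : Arrow y t) : IsNormal k (f ≫ pathMor k (Quiver.Hom.toPath (show y ⟶ t from e))) := by
  cases e with
  | α j =>
    cases hf with
    | aa h =>
      have : A k h ≫ pathMor k (Quiver.Hom.toPath (Arrow.α j : Vertex.a j ⟶ Vertex.b j)) =
          cross k h le_rfl := by
        rw [cross, B_self, Category.comp_id]; rfl
      rw [this]
      exact .ab _ _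
  | β' j =>
    cases hf with
    | aa h =>
      have : A k h ≫ pathMor k (Quiver.Hom.toPath (Arrow.β' j : Vertex.a (j + 1) ⟶ Vertex.a j)) =
          A k (show j ≤ _ by omega) := (A_succ k h _).symm
      rw [this]
      exact .aa _
  | γ j =>
    have e : pathMor k (Quiver.Hom.toPath (Arrow.γ j : Vertex.b j ⟶ Vertex.b (j + 1))) =
        B k (show j ≤ j + 1 by omega) := (B_one k j _).symm
    rw [e]
    cases hf with
    | bb h => rw [B_comp]; exact .bb _
    | ab h h' =>
      rw [cross, Category.assoc, Category.assoc, B_comp]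
      exact .ab _ (h'.trans (by omega))

theorem isNormal_pathMor {x y : Vertex} (p : Quiver.Path x y) : IsNormal k (pathMor k p) := by
  induction p with
  | nil =>
    rw [pathMor_nil]
    cases x with
    | a i => rw [← A_self]; exact .aa le_rfl
    | b i => rw [← B_self]; exact .bb le_rfl
  | cons p e ih =>
    rw [pathMor_cons]
    exact ih.comp_arrow k e

theorem IsNormal.eq_zero_or_gen {x y : Vertex} {f : obj k x ⟶ obj k y} (hf : IsNormal k f) :
    f = 0 ∨ f = gen k x y := by
  cases hf with
  | aa h => exact Or.inr (gen_aa k h).symm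
  | bb h => exact Or.inr (gen_bb k h).symm
  | ab h h' => exact cross_eq_zero_or_gen k h h'

theorem exists_smul_gen {x y : Vertex} (f : obj k x ⟶ obj k y) : ∃ c : k, c • gen k x y = f := by
  induction f using mor_induction with
  | path p =>
    rcases (isNormal_pathMor k p).eq_zero_or_gen with h | h
    · exact ⟨0, by rw [h, zero_smul]⟩
    · exact ⟨1, by rw [h, one_smul]⟩
  | zero => exact ⟨0, zero_smul _ _⟩
  | add f g hf hg =>
    obtain ⟨c, rfl⟩ := hf
    obtain ⟨d, rfl⟩ := hg
    exact ⟨c + d, add_smul _ _ _⟩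
  | smul c f hf =>
    obtain ⟨d, rfl⟩ := hf
    exact ⟨c * d, mul_smul _ _ _⟩

theorem gen_ne_zero_of_ne_zero {x y : Vertex} {f : obj k x ⟶ obj k y} (hf : f ≠ 0) :
    gen k x y ≠ 0 := by
  obtain ⟨c, rfl⟩ := exists_smul_gen k f
  intro h
  exact hf (by rw [h, smul_zero])

theorem isSchurian : IsSchurian k (Ladder k) := by
  intro x y
  have h : Module.rank k (x ⟶ y) ≤ 1 :=
    rank_le_one_iff.2 ⟨gen k x.as y.as, fun f => exists_smul_gen k (x := x.as) (y := y.as) f⟩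
  rcases Cardinal.le_one_iff.1 h with h | h
  · exact Or.inl h
  · exact Or.inr h

theorem infinite : Infinite (Ladder k) :=
  Infinite.of_injective (fun i : ℤ => obj k (.a i)) fun i j h => by
    have := congrArg Quotient.as h
    exact Vertex.a.inj this

/-! ### Squares -/

theorem isTwoCell_of_gen {x y t : Vertex} (h : IsTwoCell (obj k x) (obj k y) (obj k t)) :
    gen k x y ≫ gen k y t ≠ 0 := by
  obtain ⟨f, g, hfg⟩ := h
  obtain ⟨c, rfl⟩ := exists_smul_gen k f
  obtain ⟨d, rfl⟩ := exists_smul_gen k g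
  intro h
  simp [h] at hfg

theorem gen_aab {i j m : ℤ} (h : m ≤ i) : gen k (.a i) (.a m) ≫ gen k (.a m) (.b j) =
    cross k (i := i) (j := j) ((min_le_left m j).trans h) (min_le_right m j) := by
  rw [gen_aa k h, gen, cross, ← Category.assoc, A_comp]
  rfl

theorem gen_abb {i j m : ℤ} (h : m ≤ j) : gen k (.a i) (.b m) ≫ gen k (.b m) (.b j) =
    cross k (i := i) (j := j) (min_le_left i m) ((min_le_right i m).trans h) := by
  rw [gen_bb k h, gen, cross, Category.assoc, Category.assoc, B_comp]
  rfl

theorem squareIsFilled_iff (i : ℤ) :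
    SquareIsFilled (Ladder.a k (i + 1)) (Ladder.a k i) (Ladder.b k i) (Ladder.b k (i + 1)) ↔
      i ≠ 0 := by
  change SquareIsFilled (obj k (.a (i + 1))) (obj k (.a i)) (obj k (.b i)) (obj k (.b (i + 1))) ↔ _
  constructor
  · rintro (⟨-, h⟩ | ⟨-, h⟩) rfl
    · refine isTwoCell_of_gen k h ?_
      rw [gen_abb k (by omega)]
      exact cross_eq_zero k _ _ (by omega) (by omega) (by omega)
    · refine isTwoCell_of_gen k h ?_
      rw [gen_aab k (by omega)]
      exact cross_eq_zero k _ _ (by omega) (by omega) (by omega)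
  · intro hi
    refine Or.inl ⟨⟨gen k _ _, gen k _ _, ?_⟩, ⟨gen k _ _, gen k _ _, ?_⟩⟩
    · rw [gen_aab k (by omega)]
      exact cross_ne_zero k _ _ (by omega)
    · rw [gen_abb k (by omega)]
      exact cross_ne_zero k _ _ (by omega)

end Ladder

/-! ### Gradings given by a degree function -/

namespace Grading

variable {k : Type z} [Field k] {C : Type u} [Category.{v} C] [Preadditive C] [Linear k C]
variable {Γ : Type w} [Group Γ]

open scoped Classical in
/-- The grading for which all morphisms from `x` to `y` have degree `d x y`. -/
def ofDegree (d : C → C → Γ)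
    (h : ∀ {x y t : C} (f : x ⟶ y) (g : y ⟶ t), f ≫ g ≠ 0 → d x t = d y t * d x y) :
    Grading k C Γ where
  comp x y s := if s = d x y then ⊤ else ⊥
  isInternal x y := by
    rw [DirectSum.isInternal_submodule_iff_iSupIndep_and_iSup_eq_top]
    constructor
    · intro s
      by_cases hs : s = d x y
      · have : (⨆ (t) (_ : t ≠ s), if t = d x y then (⊤ : Submodule k (x ⟶ y)) else ⊥) = ⊥ := by
          simp only [iSup_eq_bot]
          intro t ht
          rw [if_neg (hs ▸ ht)]
        rw [this]
        exact disjoint_bot_right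
      · simp only [if_neg hs]
        exact disjoint_bot_left
    · rw [eq_top_iff]
      exact le_iSup_of_le (d x y) (by rw [if_pos rfl])
  comp_mem {x y t a b f g} hf hg := by
    by_cases h0 : f ≫ g = 0
    · rw [h0]; exact Submodule.zero_mem _
    · have ha : a = d x y := by
        by_contra hne
        rw [if_neg hne, Submodule.mem_bot] at hf
        exact h0 (by rw [hf, Limits.zero_comp])
      have hb : b = d y t := by
        by_contra hne
        rw [if_neg hne, Submodule.mem_bot] at hg
        exact h0 (by rw [hg, Limits.comp_zero])
      rw [ha, hb, if_pos (h f g h0).symm]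
      trivial

theorem mem_ofDegree {d : C → C → Γ}
    (h : ∀ {x y t : C} (f : x ⟶ y) (g : y ⟶ t), f ≫ g ≠ 0 → d x t = d y t * d x y)
    {x y : C} (f : x ⟶ y) : f ∈ (ofDegree (k := k) d h).comp x y (d x y) := by
  simp [ofDegree]

theorem ofDegree_le {d : C → C → Γ}
    (h : ∀ {x y t : C} (f : x ⟶ y) (g : y ⟶ t), f ≫ g ≠ 0 → d x t = d y t * d x y)
    {x y : C} {s : Γ} {S : Submodule k (x ⟶ y)} (hS : s = d x y → S = ⊤) :
    (ofDegree (k := k) d h).comp x y s ≤ S := by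
  by_cases hs : s = d x y
  · rw [hS hs]; exact le_top
  · simp [ofDegree, hs]

variable {X : Grading k C Γ}

theorem HomogWalk.trans {x y t : C} {r s : Γ} (p : X.HomogWalk x y r) (q : X.HomogWalk y t s) :
    X.HomogWalk x t (s * r) := by
  induction q with
  | nil => simpa using p
  | forward f hf hft _ ih => rw [mul_assoc]; exact .forward f hf hft ih
  | backward f hf hft _ ih => rw [mul_assoc]; exact .backward f hf hft ih

theorem HomogWalk.single {x y : C} {s : Γ} (f : x ⟶ y) (hf : f ≠ 0) (hs : f ∈ X.comp x y s) :
    X.HomogWalk x y s := by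
  simpa using HomogWalk.forward f hf hs (.nil x)

theorem HomogWalk.symm {x y : C} {s : Γ} (p : X.HomogWalk x y s) : X.HomogWalk y x s⁻¹ := by
  induction p with
  | nil => simpa using HomogWalk.nil (X := X) _
  | forward f hf hft _ ih =>
    have := HomogWalk.trans (HomogWalk.backward f hf hft (.nil _)) ih
    simpa using this
  | backward f hf hft _ ih =>
    have := HomogWalk.trans (HomogWalk.forward f hf hft (.nil _)) ih
    simpa using this

theorem HomogWalk.eqvGen {x y : C} {s : Γ} (p : X.HomogWalk x y s) :
    Relation.EqvGen (fun x y : C => ∃ f : x ⟶ y, f ≠ 0) x y := by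
  induction p with
  | nil => exact .refl _
  | forward f hf _ _ ih => exact .trans _ _ _ ih (.rel _ _ ⟨f, hf⟩)
  | backward f hf _ _ ih => exact .trans _ _ _ ih (.symm _ _ (.rel _ _ ⟨f, hf⟩))

theorem HomogWalk.zpow {x : C} {s : Γ} (p : X.HomogWalk x x s) (n : ℤ) :
    X.HomogWalk x x (s ^ n) := by
  have hnat : ∀ n : ℕ, X.HomogWalk x x (s ^ n) := by
    intro n
    induction n with
    | zero => simpa using HomogWalk.nil (X := X) x
    | succ n ih => rw [pow_succ]; exact p.trans ih
  cases n with
  | ofNat n => simpa using hnat n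
  | negSucc n => simpa using (hnat (n + 1)).symm

end Grading

/-! ### The universal grading of the ladder -/

namespace Ladder

variable (k : Type z) [Field k]

/-- The degree of the universal grading: the morphisms from `a i` to `b j` with `i` and `j`
positive have degree one, all others have degree zero. A path from `a i` to `b j` with `i` and `j`
positive which uses an arrow `α m` with `m ≤ 0` is zero, so degrees add up along non-zero
composites. -/
def deg : Vertex → Vertex → ℤ
  | .a i, .b j => if 0 < i ∧ 0 < j then 1 else 0
  | _, _ => 0

theorem deg_gen {x y t : Vertex} (h : gen k x y ≫ gen k y t ≠ 0) :
    deg x t = deg y t + deg x y := by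
  have h₁ : gen k x y ≠ 0 := fun h0 => h (by rw [h0, Limits.zero_comp])
  have h₂ : gen k y t ≠ 0 := fun h0 => h (by rw [h0, Limits.comp_zero])
  cases x <;> cases y <;> cases t <;> try rfl
  · rename_i i m j
    have hm : m ≤ i := by
      by_contra hm
      exact h₁ (dif_neg hm)
    rw [gen_aab k hm] at h
    have hn : ¬ (min m j ≤ 0 ∧ 0 < i ∧ 0 < j) :=
      fun hn => h (cross_eq_zero k _ _ hn.1 hn.2.1 hn.2.2)
    simp only [deg, add_zero]
    congr 1
    simp only [eq_iff_iff]
    omega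
  · exact absurd rfl h₂
  · rename_i i m j
    have hm : m ≤ j := by
      by_contra hm
      exact h₂ (dif_neg hm)
    rw [gen_abb k hm] at h
    have hn : ¬ (min i m ≤ 0 ∧ 0 < i ∧ 0 < j) :=
      fun hn => h (cross_eq_zero k _ _ hn.1 hn.2.1 hn.2.2)
    simp only [deg, zero_add]
    congr 1
    simp only [eq_iff_iff]
    omega
  · exact absurd rfl h₁

theorem deg_comp {x y t : Ladder k} (f : x ⟶ y) (g : y ⟶ t) (h : f ≫ g ≠ 0) :
    deg x.as t.as = deg y.as t.as + deg x.as y.as :=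
  deg_gen k (isTwoCell_of_gen k (x := x.as) (y := y.as) (t := t.as) ⟨f, g, h⟩)

/-- The group of the universal grading: the integers, in an arbitrary universe. -/
abbrev UGroup : Type w := ULift.{w} (Multiplicative ℤ)

/-- The degree of the morphisms between two objects of the ladder category, as an element of
the group `UGroup`. -/
def udeg (x y : Ladder k) : UGroup.{w} := ⟨Multiplicative.ofAdd (deg x.as y.as)⟩

theorem udeg_comp {x y t : Ladder k} (f : x ⟶ y) (g : y ⟶ t) (h : f ≫ g ≠ 0) :
    udeg.{w} k x t = udeg k y t * udeg k x y := by
  simp only [udeg, deg_comp k f g h]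
  rfl

/-- The universal grading of the ladder category, by the integers. -/
def grading : Grading k (Ladder k) UGroup.{w} :=
  Grading.ofDegree (udeg k) (udeg_comp k)

theorem mem_grading {x y : Vertex} (f : obj k x ⟶ obj k y) :
    f ∈ (grading.{w} k).comp (obj k x) (obj k y) ⟨Multiplicative.ofAdd (deg x y)⟩ :=
  Grading.mem_ofDegree (udeg_comp k) f

theorem walk_gen {x y : Vertex} (h : gen k x y ≠ 0) :
    (grading.{w} k).HomogWalk (obj k x) (obj k y) ⟨Multiplicative.ofAdd (deg x y)⟩ :=
  Grading.HomogWalk.single (gen k x y) h (mem_grading k _)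

theorem exists_walk (x : Vertex) : ∃ s, (grading.{w} k).HomogWalk (obj k (.a 1)) (obj k x) s := by
  have h : ∀ i, ∃ s, (grading.{w} k).HomogWalk (obj k (.a 1)) (obj k (.b i)) s :=
    fun i => ⟨_, walk_gen k (gen_ab_ne_zero k 1 i)⟩
  cases x with
  | b i => exact h i
  | a i =>
    obtain ⟨s, hs⟩ := h 1
    exact ⟨_, hs.trans (walk_gen k (gen_ab_ne_zero k i 1)).symm⟩

/-- The loop `a 1 → b 1 ← b 0 ← a 1` has degree one. -/
theorem walk_loop : (grading.{w} k).HomogWalk (obj k (.a 1)) (obj k (.a 1))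
    ⟨Multiplicative.ofAdd 1⟩ := by
  have h₁ := walk_gen.{w} k (gen_ab_ne_zero k 1 1)
  have h₂ := walk_gen.{w} k (gen_ab_ne_zero k 1 0)
  have h₃ := walk_gen.{w} k (x := .b 0) (y := .b 1)
    (by rw [gen_bb k (by omega)]; exact B_ne_zero k _)
  exact (h₁.trans h₃.symm).trans h₂.symm

theorem grading_isConnected : (grading.{w} k).IsConnected := by
  intro x y s
  obtain ⟨r, hr⟩ := exists_walk.{w} k x.as
  obtain ⟨t, ht⟩ := exists_walk.{w} k y.as
  have h := (hr.symm.trans ((walk_loop k).zpow (Multiplicative.toAdd (t⁻¹ * s * r).down))).trans ht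
  have e : (⟨Multiplicative.ofAdd 1⟩ : UGroup.{w}) ^ Multiplicative.toAdd (t⁻¹ * s * r).down =
      t⁻¹ * s * r := by
    refine ULift.ext _ _ ?_
    change (Multiplicative.ofAdd (1 : ℤ)) ^ Multiplicative.toAdd (t⁻¹ * s * r).down = _
    rw [← ofAdd_zsmul, smul_eq_mul, mul_one]
    rfl
  rw [e] at h
  have e' : t * (t⁻¹ * s * r * r⁻¹) = s := by group
  rw [e'] at h
  exact h

theorem isWalkConnected : IsWalkConnected (Ladder k) :=
  fun x y => (grading_isConnected.{0} k x y 1).eqvGen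

/-- The universal grading, with its group. -/
def universalGrading : ConnGrading.{0, z, w, z} k (Ladder k) where
  Γ := UGroup.{w}
  grading := grading.{w} k
  connected := grading_isConnected k

section Potential

variable {k} {Γ : Type w} [Group Γ] (X : Grading k (Ladder k) Γ)

/-- The degree in the grading `X` of the morphisms between two vertices. -/
def dX (x y : Vertex) : Γ := X.degree (isSchurian k) (obj k x) (obj k y)

theorem dX_gen {x y t : Vertex} (h : gen k x y ≫ gen k y t ≠ 0) :
    dX X x t = dX X y t * dX X x y :=
  X.degree_comp (isSchurian k) h

theorem dX_aaa {i j m : ℤ} (h : j ≤ i) (h' : m ≤ j) :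
    dX X (.a i) (.a m) = dX X (.a j) (.a m) * dX X (.a i) (.a j) := by
  refine dX_gen X ?_
  rw [gen_aa k h, gen_aa k h', A_comp]
  exact A_ne_zero k _

theorem dX_bbb {i j m : ℤ} (h : i ≤ j) (h' : j ≤ m) :
    dX X (.b i) (.b m) = dX X (.b j) (.b m) * dX X (.b i) (.b j) := by
  refine dX_gen X ?_
  rw [gen_bb k h, gen_bb k h', B_comp]
  exact B_ne_zero k _

/-- The degree of a crossing morphism, read on any path not separated from it by the zero
relation. -/
theorem dX_ab {i j m : ℤ} (h : m ≤ i) (h' : m ≤ j) (hm : 0 < m ∨ i ≤ 0 ∨ j ≤ 0) :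
    dX X (.a i) (.b j) =
      dX X (.b m) (.b j) * dX X (.a m) (.b m) * dX X (.a i) (.a m) := by
  have h₁ : dX X (.a i) (.b j) = dX X (.a m) (.b j) * dX X (.a i) (.a m) := by
    refine dX_gen X ?_
    rw [gen_aab k h]
    exact cross_ne_zero k _ _ (by omega)
  have h₂ : dX X (.a m) (.b j) = dX X (.b m) (.b j) * dX X (.a m) (.b m) := by
    refine dX_gen X ?_
    rw [gen_abb k h']
    exact cross_ne_zero k _ _ (by omega)
  rw [h₁, h₂]

/-- The change of base points: the degree of the walk from `a 0` to `x` along the arrow `α 0` (when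
`x` is a vertex `b j`) and the horizontal lines. Going through the common target of index `min i 0`,
resp. `max j 0`, avoids distinguishing the sign of the index. -/
def potential : Vertex → Γ
  | .a i => (dX X (.a i) (.a (min i 0)))⁻¹ * dX X (.a 0) (.a (min i 0))
  | .b j => (dX X (.b j) (.b (max j 0)))⁻¹ * dX X (.b 0) (.b (max j 0)) * dX X (.a 0) (.b 0)

theorem potential_a {i m : ℤ} (h : m ≤ i) (h' : m ≤ 0) :
    potential X (.a i) = (dX X (.a i) (.a m))⁻¹ * dX X (.a 0) (.a m) := by
  rw [potential, dX_aaa X (min_le_left i 0) (le_min h h'),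
    dX_aaa X (min_le_right i 0) (le_min h h')]
  group

theorem potential_b {j m : ℤ} (h : j ≤ m) (h' : 0 ≤ m) :
    potential X (.b j) = (dX X (.b j) (.b m))⁻¹ * dX X (.b 0) (.b m) * dX X (.a 0) (.b 0) := by
  rw [potential, dX_bbb X (le_max_left j 0) (max_le h h'),
    dX_bbb X (le_max_right j 0) (max_le h h')]
  group

theorem dX_aa {i j : ℤ} (h : j ≤ i) :
    dX X (.a i) (.a j) = potential X (.a j) * (potential X (.a i))⁻¹ := by
  rw [potential_a X (m := min j 0) (by omega) (by omega),
    potential_a X (i := i) (m := min j 0) (by omega) (by omega), dX_aaa X h (min_le_left j 0)]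
  group

theorem dX_bb {i j : ℤ} (h : i ≤ j) :
    dX X (.b i) (.b j) = potential X (.b j) * (potential X (.b i))⁻¹ := by
  rw [potential_b X (m := max j 0) (by omega) (by omega),
    potential_b X (j := i) (m := max j 0) (by omega) (by omega), dX_bbb X h (le_max_left j 0)]
  group

/-- On the non-positive part of the ladder all squares commute, so that the degrees in `X` come
from the potential. -/
theorem dX_ab_of_nonpos {m : ℤ} (h : m ≤ 0) :
    dX X (.a m) (.b m) = potential X (.b m) * (potential X (.a m))⁻¹ := by
  have h₀ := dX_ab X (i := 0) (j := 0) h h (by omega)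
  have h₁ : potential X (.a 0) = 1 := by
    rw [potential_a X le_rfl le_rfl, inv_mul_cancel]
  have h₂ : potential X (.b 0) = dX X (.a 0) (.b 0) := by
    rw [potential_b X le_rfl le_rfl, inv_mul_cancel, one_mul]
  rw [dX_aa X h, dX_bb X h, ← h₂, h₁] at h₀
  simp only [inv_one, mul_one] at h₀
  have h₃ : potential X (.b 0) * 1 = potential X (.b 0) *
      ((potential X (.b m))⁻¹ * dX X (.a m) (.b m) * potential X (.a m)) := by
    rw [mul_one]
    conv_lhs => rw [h₀]
    simp only [mul_assoc]
  have h₄ := mul_left_cancel h₃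
  rw [mul_assoc, eq_comm, inv_mul_eq_one] at h₄
  rw [eq_mul_inv_iff_mul_eq, h₄]

/-- The degree of the loop around the square of the zero relation: from `a 0` to `a 1`, to `b 1`
along `α 1`, and back through `b 0` and `α 0`. -/
def loopDegree : Γ := (potential X (.b 1))⁻¹ * dX X (.a 1) (.b 1) * potential X (.a 1)

/-- Any grading of the ladder category is deduced from the universal degree: the generator of `ℤ` is
sent to `loopDegree`, and the base points are changed by `potential`. -/
theorem dX_eq {x y : Vertex} (h : gen k x y ≠ 0) :
    dX X x y = potential X y * loopDegree X ^ deg x y * (potential X x)⁻¹ := by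
  cases x with
  | a i =>
    cases y with
    | a j =>
      have hj : j ≤ i := by
        by_contra hj
        exact h (dif_neg hj)
      rw [dX_aa X hj, deg, zpow_zero, mul_one]
      simp
    | b j =>
      by_cases hp : 0 < i ∧ 0 < j
      · rw [dX_ab X (m := 1) (by omega) (by omega) (by omega), dX_bb X (by omega),
          dX_aa X (by omega), deg, if_pos hp, zpow_one, loopDegree]
        group
      · rw [dX_ab X (m := min (min i j) 0) (by omega) (by omega) (by omega), dX_bb X (by omega),
          dX_aa X (by omega), dX_ab_of_nonpos X (by omega), deg, if_neg hp]
        group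
  | b i =>
    cases y with
    | a j => exact absurd rfl h
    | b j =>
      have hj : i ≤ j := by
        by_contra hj
        exact h (dif_neg hj)
      rw [dX_bb X hj, deg, zpow_zero, mul_one]
      all_goals simp

end Potential

theorem universalGrading_isUniversal : (universalGrading.{w} k).IsUniversal := by
  refine ConnGrading.isUniversal_of_factorization (isSchurian k) _ fun X => ?_
  refine ⟨(zpowersHom X.Γ (loopDegree X.grading)).comp MulEquiv.ulift.toMonoidHom,
    fun x => potential X.grading x.as, fun x y s => Grading.ofDegree_le (udeg_comp k) ?_⟩
  rintro rfl
  rw [eq_top_iff]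
  intro f _
  by_cases hf : f = 0
  · rw [hf]; exact Submodule.zero_mem _
  · have hg := gen_ne_zero_of_ne_zero k (x := x.as) (y := y.as) hf
    have := X.grading.mem_degree (isSchurian k) f
    have e : X.grading.degree (isSchurian k) x y = _ := dX_eq X.grading hg
    rw [e] at this
    exact this

end Ladder

/-! ### Presentations with kernel in the square of the arrow ideal -/

section Presentation

variable {k : Type z} [Field k] {Q : Type u} [Quiver.{w} Q]

open scoped Classical in
theorem arrow_notMem_arrowPow_two {x y : Q} (e : x ⟶ y) :
    arrow k e ∉ arrowPow k 2 ((Paths.of Q).obj x) ((Paths.of Q).obj y) := by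
  intro h
  -- The coefficient of the arrow vanishes on combinations of paths of length at least two.
  let φ : ((Paths.of Q).obj x ⟶ (Paths.of Q).obj y) → k :=
    fun p => if p = (Paths.of Q).map e then 1 else 0
  have hker : arrowPow k 2 ((Paths.of Q).obj x) ((Paths.of Q).obj y) ≤
      LinearMap.ker (freeEval k φ) := by
    refine Submodule.span_le.2 ?_
    rintro _ ⟨p, hp, rfl⟩
    refine (freeEval_map k φ p).trans (if_neg ?_)
    rintro rfl
    exact absurd hp (by decide : ¬ (2 ≤ 1))
  have h₁ : freeEval k φ (arrow k e) = 0 := hker h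
  have h₂ : freeEval k φ (arrow k e) = 1 := (freeEval_map k φ _).trans (if_pos rfl)
  exact one_ne_zero (h₂.symm.trans h₁)

theorem one_le_length {x y : Q} (p : Quiver.Path x y) (h : x ≠ y) : 1 ≤ p.length := by
  cases p with
  | nil => exact absurd rfl h
  | cons p e => exact Nat.succ_le_succ (Nat.zero_le _)

variable {C : Type u} [Category.{v} C] [Preadditive C] [Linear k C] {F : Free k (Paths Q) ⥤ C}

/-- The image of an arrow is not in the image of the square of the arrow ideal. -/
theorem KernelInSquare.map_arrow_ne (hF : IsPresentation k F) (hker : KernelInSquare k F)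
    {x y : Q} (e : x ⟶ y)
    {g : (Free.embedding k (Paths Q)).obj ((Paths.of Q).obj x) ⟶
      (Free.embedding k (Paths Q)).obj ((Paths.of Q).obj y)}
    (hg : g ∈ arrowPow k 2 ((Paths.of Q).obj x) ((Paths.of Q).obj y)) :
    F.map (arrow k e) ≠ F.map g := by
  intro h
  have := hF.additive
  have hmem := hker _ _ (arrow k e - g) (by rw [F.map_sub, h, sub_self])
  have := Submodule.add_mem _ hmem hg
  rw [sub_add_cancel] at this
  exact arrow_notMem_arrowPow_two e this

theorem IsPresentation.exists_path (hF : IsPresentation k F) {x y : Paths Q}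
    {f : F.obj ((Free.embedding k (Paths Q)).obj x) ⟶ F.obj ((Free.embedding k (Paths Q)).obj y)}
    (hf : f ≠ 0) : ∃ p : x ⟶ y, F.map ((Free.embedding k (Paths Q)).map p) ≠ 0 := by
  by_contra! h
  have := hF.full
  have := hF.additive
  have := hF.linear
  obtain ⟨f, rfl⟩ := F.map_surjective f
  refine hf (free_induction k (P := fun f => F.map f = 0) h (F.map_zero _ _) ?_ ?_ f)
  · intro f g hf hg
    rw [F.map_add, hf, hg, add_zero]
  · intro c f hf
    rw [F.map_smul, hf, smul_zero]

end Presentation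

namespace Ladder

variable {k : Type z} [Field k]

theorem comp_ne_zero {x y t : Vertex} (h : gen k x y ≫ gen k y t ≠ 0) {f : obj k x ⟶ obj k y}
    {g : obj k y ⟶ obj k t} (hf : f ≠ 0) (hg : g ≠ 0) : f ≫ g ≠ 0 := by
  obtain ⟨c, rfl⟩ := exists_smul_gen k f
  obtain ⟨d, rfl⟩ := exists_smul_gen k g
  rw [Linear.smul_comp, Linear.comp_smul]
  refine smul_ne_zero ?_ (smul_ne_zero ?_ h)
  · rintro rfl
    exact hf (zero_smul _ _)
  · rintro rfl
    exact hg (zero_smul _ _)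

section

variable {Q : Type} [Quiver.{w} Q] {F : Free k (Paths Q) ⥤ Ladder k}

/-- The vertex of the ladder corresponding to a vertex of a quiver presenting the ladder
category. -/
def vert (F : Free k (Paths Q) ⥤ Ladder k) (x : Paths Q) : Vertex :=
  (F.obj ((Free.embedding k (Paths Q)).obj x)).as

/-- The morphism of the ladder category given by a path of a quiver presenting it. -/
def vertMap (F : Free k (Paths Q) ⥤ Ladder k) {x y : Paths Q} (p : x ⟶ y) :
    obj k (vert F x) ⟶ obj k (vert F y) :=
  F.map ((Free.embedding k (Paths Q)).map p)

theorem exists_vert_eq (hF : IsPresentation k F) (v : Vertex) : ∃ x : Paths Q, vert F x = v := by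
  obtain ⟨x, hx⟩ := hF.bijective.2 (obj k v)
  exact ⟨x, congrArg (fun c : Ladder k => (c.as : Vertex)) hx⟩

theorem exists_vertMap_ne_zero (hF : IsPresentation k F) {x y : Paths Q}
    (h : gen k (vert F x) (vert F y) ≠ 0) : ∃ p : x ⟶ y, vertMap F p ≠ 0 :=
  hF.exists_path (x := x) (y := y) (f := show F.obj _ ⟶ F.obj _ from gen k (vert F x) (vert F y)) h

/-- A crossing morphism `a i ⟶ b j` with `i ≤ 0` factors through `a (i - 1)`, hence is not the image
of an arrow. -/
theorem not_arrow_cross (hF : IsPresentation k F) (hker : KernelInSquare k F) {x y : Q} (e : x ⟶ y)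
    {i j : ℤ} (hi : i ≤ 0) (hx : vert F ((Paths.of Q).obj x) = .a i)
    (hy : vert F ((Paths.of Q).obj y) = .b j) : False := by
  obtain ⟨t, ht⟩ := exists_vert_eq hF (.a (i - 1))
  have key : ∀ u v w : Vertex, u = .a i → v = .a (i - 1) → w = .b j →
      gen k u v ≫ gen k v w ≠ 0 := by
    rintro _ _ _ rfl rfl rfl
    rw [gen_aab k (by omega)]
    exact cross_ne_zero k _ _ (by omega)
  have h := key _ _ _ hx ht hy
  obtain ⟨p, hp⟩ := exists_vertMap_ne_zero hF (x := (Paths.of Q).obj x) (y := t)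
    fun h0 => h (by rw [h0, Limits.zero_comp])
  obtain ⟨q, hq⟩ := exists_vertMap_ne_zero hF (x := t) (y := (Paths.of Q).obj y)
    fun h0 => h (by rw [h0, Limits.comp_zero])
  have hxt : (Paths.of Q).obj x ≠ t := by
    intro h0
    rw [h0, ht] at hx
    have := Vertex.a.inj hx
    omega
  have hty : t ≠ (Paths.of Q).obj y := by
    intro h0
    rw [h0, hy] at ht
    cases ht
  have hp1 : 1 ≤ Quiver.Path.length p := one_le_length p hxt
  have hq1 : 1 ≤ Quiver.Path.length q := one_le_length q hty
  have hpq : F.map ((Free.embedding k (Paths Q)).map (p ≫ q)) ≠ 0 := by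
    rw [Functor.map_comp, Functor.map_comp]
    exact comp_ne_zero h hp hq
  obtain ⟨c, hc⟩ := (isSchurian k).exists_smul_eq hpq (F.map (arrow k e))
  have hlin := hF.linear
  rw [← F.map_smul] at hc
  refine hker.map_arrow_ne hF e (Submodule.smul_mem _ c (Submodule.subset_span ⟨p ≫ q, ?_, rfl⟩))
    hc.symm
  exact (add_le_add hp1 hq1).trans_eq (Quiver.Path.length_comp p q).symm

/-- All paths starting at the vertex `a 0` stay among the vertices `a j` with `j ≤ 0`. -/
theorem vert_of_path (hF : IsPresentation k F) (hker : KernelInSquare k F) {x y : Q}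
    (hx : vert F ((Paths.of Q).obj x) = .a 0) (p : Quiver.Path x y) :
    ∃ j ≤ 0, vert F ((Paths.of Q).obj y) = .a j := by
  induction p with
  | nil => exact ⟨0, le_rfl, hx⟩
  | @cons y t p e ih =>
    obtain ⟨i, hi, hy⟩ := ih
    have hne : gen k (vert F ((Paths.of Q).obj y)) (vert F ((Paths.of Q).obj t)) ≠ 0 := by
      have := hF.additive
      have h := hker.map_arrow_ne hF e (Submodule.zero_mem _)
      rw [F.map_zero] at h
      exact gen_ne_zero_of_ne_zero k h
    cases ht : vert F ((Paths.of Q).obj t) with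
    | a j =>
      refine ⟨j, ?_, rfl⟩
      rw [hy, ht] at hne
      by_contra hj
      exact hne (dif_neg (by omega))
    | b j => exact (not_arrow_cross hF hker e hi hy ht).elim

end

/-- In a presentation with kernel in the square of the arrow ideal, no arrow goes from the
vertices `a i` with `i ≤ 0` to the vertices `b j`, so there is no path from `a 0` to `b 0`. -/
theorem not_hasPresentationInSquare :
    ¬ HasPresentationInSquare.{0, z, w, z} k (Ladder k) := by
  rintro ⟨Q, _, F, hF, hker⟩
  obtain ⟨x, hx⟩ := exists_vert_eq hF (.a 0)
  obtain ⟨y, hy⟩ := exists_vert_eq hF (.b 0)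
  have key : ∀ u v : Vertex, u = .a 0 → v = .b 0 → gen k u v ≠ 0 := by
    rintro _ _ rfl rfl
    exact gen_ab_ne_zero k 0 0
  obtain ⟨p, -⟩ := exists_vertMap_ne_zero hF (key _ _ hx hy)
  obtain ⟨j, -, hj⟩ := vert_of_path hF hker (x := x) (y := y) hx p
  exact Vertex.noConfusion (hj.symm.trans hy)

end Ladder

end SchurianLadder

end

theorem mainTheorem9 (k : Type z) [Field k] :
    Infinite (SchurianLadder.Ladder k) ∧
    SchurianLadder.IsSchurian k (SchurianLadder.Ladder k) ∧
    SchurianLadder.IsWalkConnected (SchurianLadder.Ladder k) ∧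
    ¬ SchurianLadder.HasPresentationInSquare.{0, z, w, z} k (SchurianLadder.Ladder k) ∧
    ¬ SchurianLadder.HasAdmissiblePresentation.{0, z, w, z} k (SchurianLadder.Ladder k) ∧
    (∀ i : ℤ, SchurianLadder.SquareIsFilled
      (SchurianLadder.Ladder.a k (i + 1)) (SchurianLadder.Ladder.a k i)
      (SchurianLadder.Ladder.b k i) (SchurianLadder.Ladder.b k (i + 1)) ↔ i ≠ 0) ∧
    (∃ U : SchurianLadder.ConnGrading.{0, z, w, z} k (SchurianLadder.Ladder k), U.IsUniversal) ∧
    (∀ U : SchurianLadder.ConnGrading.{0, z, w, z} k (SchurianLadder.Ladder k),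
      U.IsUniversal → Nonempty (U.Γ ≃* Multiplicative ℤ)) ∧
    (∀ c₀ : SchurianLadder.Ladder k,
      Nonempty (SchurianLadder.IntrinsicFundamentalGroup.{0, z, w, z} k c₀ ≃*
        Multiplicative ℤ)) := by
  have hS := SchurianLadder.Ladder.isSchurian k
  have hU := SchurianLadder.Ladder.universalGrading_isUniversal.{w} k
  have hne : Nonempty (SchurianLadder.Ladder k) := ⟨SchurianLadder.Ladder.a k 0⟩
  have hP := SchurianLadder.Ladder.not_hasPresentationInSquare.{w} (k := k)
  refine ⟨SchurianLadder.Ladder.infinite k, hS, SchurianLadder.Ladder.isWalkConnected k, hP, ?_,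
    SchurianLadder.Ladder.squareIsFilled_iff k, ⟨_, hU⟩, fun V hV => ?_, fun c₀ => ?_⟩
  · rintro ⟨Q, hQ, F, hF, hker, -⟩
    exact hP ⟨Q, hQ, F, hF, hker⟩
  · obtain ⟨e⟩ := hV.nonempty_mulEquiv hS hU
    exact ⟨e.trans MulEquiv.ulift⟩
  · exact ⟨(hU.fundamentalGroupEquiv hS c₀).trans
      ((MulEquiv.inv' _).symm.trans MulEquiv.ulift)⟩
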